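/- **Setting.** Let $G=(V,E)$ be a finite directed acyclic graph (parallel edges allowed), where an edge $e$ goes from its tail $t(e)$ to its head $h(e)$. Let $\mathbf a\in\mathbb Z^V$ be a nonzero integer netflow vector. The flow polytope $\mathcal F_G(\mathbf a)$ is the set of $F\in\mathbb R_{\ge 0}^E$ with $\sum_{t(e)=i}F(e)-\sum_{h(e)=i}F(e)=\mathbf a_i$ for all $i\in V$; it may be empty. **Augmentations.** An *augmentation* $(\hat G,\hat{\mathbf a})$ of $(G,\mathbf a)$ is a finite graph $\hat G$ with vertex set $V\sqcup V_X\sqcup V_Y$ and edge set $E\sqcup E_X\sqcup E_Y$, extending $G$, with a vector $\hat{\mathbf a}$, such that 1. the edges of $E_X$ go from $V_X$ to $\{i\in V:\mathbf a_i>0\}$, and exactly $\mathbf a_i$ of them end at each $i\in V$ with $\mathbf a_i>0$; 2. the edges of $E_Y$ go from $\{i\in V:\mathbf a_i<0\}$ to $V_Y$, and at least $1$ and at most $|\mathbf a_i|$ of them start at each $i\in V$ with $\mathbf a_i<0$; 3. each vertex of $V_X$ (resp. $V_Y$) is incident to exactly one edge of $E_X$ (resp. $E_Y$); 4. $\hat{\mathbf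 a}$ is $0$ on $V$, is $1$ on $V_X$, takes negative integer values on $V_Y$, and satisfies $\mathbf a_i=\sum_{y\in E_Y,\,t(y)=i}\hat{\mathbf a}_{h(y)}$ whenever $\mathbf a_i<0$. A *framing* $\hat{\mathfrak F}$ of it consists of total orders, for each $i\in V$, on the edges of $\hat G$ leaving $i$ and on the edges of $\hat G$ entering $i$, and of a total order on $V_X$. **Routes.** A *route* is a directed path of $\hat G$ from a source (a vertex without incoming edges) to a sink (a vertex without outgoing edges). For distinct paths $p,q$ from a vertex $i$ to sinks, $p<_i^+q$ means that, at the first vertex where they diverge, the edge taken by $p$ is smaller in the order on outgoing edges than the edge taken by $q$. For distinct paths from sources to $i$, $p<_i^-q$ is defined dually, by the order on the incoming edges at the last vertex where they merge. For routes through $i$, the two relations compare their parts after, respectively before, $i$. Routes $p,q$ are *incompatible* if, at some common vertex $i$, $p<_i^-q$ and $q<_i^+p$, or $q<_i^-p$ and $p<_i^+q$. A *route-clique* is a set of pairwise compatible routes. **Layerings.** A *layering* is a set $L$ of routes such that exactly $\hat{\mathbf a}_i$ routes of $L$ start at each source $i$ of $\hat G$ and exactly $|\hat{\mathbf a}_j|$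 routes of $L$ end at each sink $j$ of $\hat G$. In particular $L$ has exactly one route $L_s$ starting at each $s\in V_X$. Layerings are totally ordered as follows: $L<M$ if $L_s<_s^+M_s$ for the greatest $s\in V_X$ with $L_s\ne M_s$. For a set of layerings, $\mathrm{routes}(\cdot)$ denotes the set of all routes belonging to its members. A set $\mathcal L=\{L^1<\dots<L^m\}$ of layerings ($m\ge0$) is a *layering-simplex* if 1. $\mathrm{routes}(\mathcal L)$ is a route-clique; 2. for each $i\in[m]$, $L^i$ is the smallest layering all of whose routes lie in $\mathrm{routes}(\{L^i,\dots,L^m\})$; 3. for each $i\in[m]$, some route of $L^i$ is not in $\mathrm{routes}(\{L^{i+1},\dots,L^m\})$. For a layering $L$ let $\check{\mathcal J}(L)\in\mathbb R^E$ be the vector whose entry at $e\in E$ is the number of routes of $L$ that use $e$, and let $\check\Delta_1(\mathcal L)=\mathrm{conv}\{\check{\mathcal J}(L):L\in\mathcal L\}$. **Theorem.** Let $G$ be a finite DAG with nonzero integer netflow vector $\mathbf a$, and let $(\hat G,\hat{\mathbf a},\hat{\mathfrak F})$ be a framed augmentation of $(G,\mathbf a)$. Then $$\mathcal T(\hat G,\hat{\mathbf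 a},\hat{\mathfrak F})=\{\check\Delta_1(\mathcal L):\mathcal L\text{ a layering-simplex}\}$$ is a unimodular lattice triangulation of $\mathcal F_G(\mathbf a)$. That is, $\mathcal F_G(\mathbf a)$ is a (possibly empty) polytope with integer vertices, $\mathcal T$ is a finite set of (possibly empty) simplices with integer vertices whose union is $\mathcal F_G(\mathbf a)$, every (possibly empty) face of a member of $\mathcal T$ is in $\mathcal T$, the intersection of any two members is a (possibly empty) face of both, and each nonempty member of $\mathcal T$ has normalized volume $1$ within its affine span. Here the normalized volume of a $d$-dimensional simplex is $d!$ times its volume, measured so that the lattice of integer points of the linear subspace parallel to its affine span has covolume $1$. -/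

import Mathlib

/-! ### Directed multigraphs, paths, routes and flows -/

/-- A directed graph with vertex set `V` and edge set `E`; parallel edges are allowed. -/
structure MultiDigraph (V E : Type*) where
  tail : E → V
  head : E → V

namespace MultiDigraph

variable {V E : Type*}

/-- `G.IsPath u l v`: the list of edges `l` is a directed path of `G` from `u` to `v`. -/
def IsPath (G : MultiDigraph V E) : V → List E → V → Prop
  | u, [], v => u = v
  | u, e :: l, v => G.tail e = u ∧ G.IsPath (G.head e) l v

/-- `G` is a DAG: it has no nonempty closed directed path. -/
def IsDAG (G : MultiDigraph V E) : Prop :=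
  ∀ (v : V) (l : List E), G.IsPath v l v → l = []

def IsSource (G : MultiDigraph V E) (v : V) : Prop := ∀ e, G.head e ≠ v

def IsSink (G : MultiDigraph V E) (v : V) : Prop := ∀ e, G.tail e ≠ v

/-- A route: a directed path from a source to a sink. -/
@[ext]
structure Route (G : MultiDigraph V E) where
  start : V
  finish : V
  edges : List E
  isPath : G.IsPath start edges finish
  isSource_start : G.IsSource start
  isSink_finish : G.IsSink finish

/-- The route `p` passes through `i`, following the edges of `l₁` before `i` and the edges of
`l₂` after `i`. -/
def Route.SplitsAt {G : MultiDigraph V E} (p : G.Route) (i : V) (l₁ l₂ : List E) : Prop :=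
  p.edges = l₁ ++ l₂ ∧ G.IsPath p.start l₁ i ∧ G.IsPath i l₂ p.finish

open Classical in
/-- The polytope of nonnegative `a`-flows of `G`. -/
def flowPolytope [Fintype E] (G : MultiDigraph V E) (a : V → ℤ) : Set (E → ℝ) :=
  {F | (∀ e, 0 ≤ F e) ∧
    ∀ i, (∑ e with G.tail e = i, F e) - (∑ e with G.head e = i, F e) = (a i : ℝ)}

end MultiDigraph

/-! ### Augmentations and their framings -/

open Classical in
/-- An augmentation of `(G, a)` with inflow vertices `VX`, inflow edges `EX`, outflow vertices
`VY` and outflow edges `EY`. -/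
structure Augmentation {V E : Type*} (G : MultiDigraph V E) (a : V → ℤ)
    (VX VY EX EY : Type*) [Fintype EX] [Fintype EY] where
  xTail : EX → VX
  xHead : EX → V
  yTail : EY → V
  yHead : EY → VY
  /-- inflow edges end at vertices of positive netflow, `a i` of them at each such vertex `i` -/
  xHead_pos : ∀ x, 0 < a (xHead x)
  card_xHead : ∀ i, 0 < a i → ((Finset.univ.filter fun x => xHead x = i).card : ℤ) = a i
  /-- outflow edges start at vertices of negative netflow, between `1` and `|a i|` of them at each
  such vertex `i` -/
  yTail_neg : ∀ y, a (yTail y) < 0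
  one_le_card_yTail : ∀ i, a i < 0 → 1 ≤ (Finset.univ.filter fun y => yTail y = i).card
  card_yTail_le : ∀ i, a i < 0 → ((Finset.univ.filter fun y => yTail y = i).card : ℤ) ≤ |a i|
  /-- every inflow (outflow) vertex is incident to precisely one inflow (outflow) edge -/
  existsUnique_x : ∀ v : VX, ∃! x, xTail x = v
  existsUnique_y : ∀ v : VY, ∃! y, yHead y = v
  /-- the netflow at the outflow vertices -/
  aY : VY → ℤ
  aY_neg : ∀ v, aY v < 0
  sum_aY : ∀ i, a i < 0 → a i = ∑ y with yTail y = i, aY (yHead y)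

namespace Augmentation

variable {V E VX VY EX EY : Type*} [Fintype EX] [Fintype EY]
  {G : MultiDigraph V E} {a : V → ℤ}

/-- The augmented graph, with vertex set `V ⊔ VX ⊔ VY` and edge set `E ⊔ EX ⊔ EY`. -/
def graph (A : Augmentation G a VX VY EX EY) : MultiDigraph (V ⊕ VX ⊕ VY) (E ⊕ EX ⊕ EY) where
  tail
    | .inl e => .inl (G.tail e)
    | .inr (.inl x) => .inr (.inl (A.xTail x))
    | .inr (.inr y) => .inl (A.yTail y)
  head
    | .inl e => .inl (G.head e)
    | .inr (.inl x) => .inl (A.xHead x)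
    | .inr (.inr y) => .inr (.inr (A.yHead y))

/-- The netflow vector of the augmented graph. -/
def netflow (A : Augmentation G a VX VY EX EY) : V ⊕ VX ⊕ VY → ℤ
  | .inl _ => 0
  | .inr (.inl _) => 1
  | .inr (.inr v) => A.aY v

/-- A framing: total orders on the outgoing and on the incoming edges (in the augmented graph) of
each vertex of `V`, and a total order on the inflow vertices. -/
structure Framing (A : Augmentation G a VX VY EX EY) where
  out : ∀ i : V, LinearOrder {e : E ⊕ EX ⊕ EY // A.graph.tail e = .inl i}
  inc : ∀ i : V, LinearOrder {e : E ⊕ EX ⊕ EY // A.graph.head e = .inl i}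
  src : LinearOrder VX

namespace Framing

variable {A : Augmentation G a VX VY EX EY}

/-- `f` and `g` leave a common vertex of `V`, and `f` is smaller in the order there. -/
def OutLT (F : A.Framing) (f g : E ⊕ EX ⊕ EY) : Prop :=
  ∃ (i : V) (hf : A.graph.tail f = .inl i) (hg : A.graph.tail g = .inl i),
    (F.out i).lt ⟨f, hf⟩ ⟨g, hg⟩

/-- `f` and `g` enter a common vertex of `V`, and `f` is smaller in the order there. -/
def IncLT (F : A.Framing) (f g : E ⊕ EX ⊕ EY) : Prop :=
  ∃ (i : V) (hf : A.graph.head f = .inl i) (hg : A.graph.head g = .inl i),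
    (F.inc i).lt ⟨f, hf⟩ ⟨g, hg⟩

/-- The post-`i` order, for paths `p` and `q` from a common vertex `i` to sinks. -/
def PostLT (F : A.Framing) (p q : List (E ⊕ EX ⊕ EY)) : Prop :=
  ∃ σ f g p' q', p = σ ++ f :: p' ∧ q = σ ++ g :: q' ∧ F.OutLT f g

/-- The pre-`i` order, for paths `p` and `q` from sources to a common vertex `i`. -/
def PreLT (F : A.Framing) (p q : List (E ⊕ EX ⊕ EY)) : Prop :=
  ∃ σ f g p' q', p = p' ++ f :: σ ∧ q = q' ++ g :: σ ∧ F.IncLT f g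

/-- `p` and `q` share a vertex `i` at which `p <⁻ q` and `q <⁺ p`. -/
def Cross (F : A.Framing) (p q : A.graph.Route) : Prop :=
  ∃ i p₁ p₂ q₁ q₂, p.SplitsAt i p₁ p₂ ∧ q.SplitsAt i q₁ q₂ ∧ F.PreLT p₁ q₁ ∧ F.PostLT q₂ p₂

def Compatible (F : A.Framing) (p q : A.graph.Route) : Prop := ¬ F.Cross p q ∧ ¬ F.Cross q p

def IsRouteClique (F : A.Framing) (R : Set A.graph.Route) : Prop :=
  ∀ p ∈ R, ∀ q ∈ R, F.Compatible p q

end Framing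

open Classical in
/-- A layering: a set of routes of the augmented graph, with as many routes starting at each source
and ending at each sink as the netflow vector prescribes. (A source or sink that lies in `V` has
netflow `0`.) -/
def IsLayering (A : Augmentation G a VX VY EX EY) (L : Finset A.graph.Route) : Prop :=
  (∀ i, A.graph.IsSource i → ((L.filter fun p => p.start = i).card : ℤ) = A.netflow i) ∧
  (∀ j, A.graph.IsSink j → ((L.filter fun p => p.finish = j).card : ℤ) = |A.netflow j|)

/-- The set of routes used by a set of layerings. -/
def routes (A : Augmentation G a VX VY EX EY) (S : Set (Finset A.graph.Route)) :
    Set A.graph.Route :=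
  {p | ∃ L ∈ S, p ∈ L}

/-- The post-source order on layerings: at the greatest inflow vertex `s` where `L` and `M` have
different routes, the route of `L` is smaller than that of `M` in the post-`s` order. -/
def Framing.SrcLT {A : Augmentation G a VX VY EX EY} (F : A.Framing)
    (L M : Finset A.graph.Route) : Prop :=
  ∃ s : VX,
    (∃ p ∈ L, ∃ q ∈ M, p.start = .inr (.inl s) ∧ q.start = .inr (.inl s) ∧
      F.PostLT p.edges q.edges) ∧
    ∀ s' : VX, F.src.lt s s' → ∀ p ∈ L, ∀ q ∈ M,
      p.start = .inr (.inl s') → q.start = .inr (.inl s') → p = q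

/-- A layering-simplex. If `S = {L¹ < ⋯ < Lᵐ}` and `L = Lⁱ`, then `{N ∈ S | N = L ∨ L < N}` is
`{Lⁱ, …, Lᵐ}` and `{N ∈ S | L < N}` is `{Lⁱ⁺¹, …, Lᵐ}`. -/
structure Framing.IsLayeringSimplex {A : Augmentation G a VX VY EX EY} (F : A.Framing)
    (S : Finset (Finset A.graph.Route)) : Prop where
  isLayering : ∀ L ∈ S, A.IsLayering L
  isRouteClique : F.IsRouteClique (A.routes S)
  isMin : ∀ L ∈ S, ∀ M, A.IsLayering M →
    (∀ p ∈ M, p ∈ A.routes {N | N ∈ S ∧ (N = L ∨ F.SrcLT L N)}) → M = L ∨ F.SrcLT L M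
  exists_new : ∀ L ∈ S, ∃ p ∈ L, p ∉ A.routes {N | N ∈ S ∧ F.SrcLT L N}

open Classical in
/-- The deaugmented indicator vector of a route. -/
noncomputable def routeIndicator (A : Augmentation G a VX VY EX EY) (p : A.graph.Route) : E → ℝ :=
  fun e => if Sum.inl e ∈ p.edges then 1 else 0

/-- The deaugmented indicator vector of a layering. -/
noncomputable def layeringIndicator (A : Augmentation G a VX VY EX EY)
    (L : Finset A.graph.Route) : E → ℝ :=
  ∑ p ∈ L, A.routeIndicator p

/-- The deaugmented polyhedral simplex of a set of layerings. -/
noncomputable def polyhedralSimplex (A : Augmentation G a VX VY EX EY)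
    (S : Finset (Finset A.graph.Route)) : Set (E → ℝ) :=
  convexHull ℝ (A.layeringIndicator '' S)

/-- The collection of the deaugmented polyhedral simplices of all layering-simplices. -/
def Framing.triangulation {A : Augmentation G a VX VY EX EY} (F : A.Framing) :
    Set (Set (E → ℝ)) :=
  {Δ | ∃ S, F.IsLayeringSimplex S ∧ Δ = A.polyhedralSimplex S}

end Augmentation

/-! ### Unimodular lattice triangulations -/

section Triangulation

variable {E : Type*}

def IsIntegerPoint (x : E → ℝ) : Prop := ∀ e, ∃ n : ℤ, x e = n

/-- A (possibly empty) integer polytope. -/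
def IsIntegerPolytope (P : Set (E → ℝ)) : Prop :=
  ∃ s : Finset (E → ℝ), (∀ x ∈ s, IsIntegerPoint x) ∧ P = convexHull ℝ (s : Set (E → ℝ))

/-- `s` is the vertex set of the (possibly empty) simplex `Δ`. -/
def IsVertexSet (s : Finset (E → ℝ)) (Δ : Set (E → ℝ)) : Prop :=
  AffineIndependent ℝ ((↑) : s → E → ℝ) ∧ Δ = convexHull ℝ (s : Set (E → ℝ))

def IsIntegerSimplex (Δ : Set (E → ℝ)) : Prop :=
  ∃ s : Finset (E → ℝ), (∀ x ∈ s, IsIntegerPoint x) ∧ IsVertexSet s Δ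

/-- `Δ'` is a (possibly empty) face of the simplex `Δ`. -/
def IsSimplexFace (Δ' Δ : Set (E → ℝ)) : Prop :=
  ∃ s t : Finset (E → ℝ), IsVertexSet s Δ ∧ t ⊆ s ∧ Δ' = convexHull ℝ (t : Set (E → ℝ))

structure IsLatticeTriangulation (P : Set (E → ℝ)) (T : Set (Set (E → ℝ))) : Prop where
  isIntegerPolytope : IsIntegerPolytope P
  finite : T.Finite
  isIntegerSimplex : ∀ Δ ∈ T, IsIntegerSimplex Δ
  eq_sUnion : P = ⋃₀ T
  face_mem : ∀ Δ ∈ T, ∀ Δ', IsSimplexFace Δ' Δ → Δ' ∈ T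
  inter_face : ∀ Δ₁ ∈ T, ∀ Δ₂ ∈ T, IsSimplexFace (Δ₁ ∩ Δ₂) Δ₁ ∧ IsSimplexFace (Δ₁ ∩ Δ₂) Δ₂

/-- The lattice of integer points of a linear subspace. -/
def integerPoints (W : Submodule ℝ (E → ℝ)) : Submodule ℤ W where
  carrier := {w | IsIntegerPoint (w : E → ℝ)}
  zero_mem' := fun _ => ⟨0, by simp⟩
  add_mem' := fun {v w} hv hw e => by
    obtain ⟨m, hm⟩ := hv e
    obtain ⟨n, hn⟩ := hw e
    exact ⟨m + n, by simp [hm, hn]⟩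
  smul_mem' := fun c w hw e => by
    obtain ⟨n, hn⟩ := hw e
    exact ⟨c * n, by simp [hn]⟩

set_option synthInstance.maxHeartbeats 200000 in
/-- The volume of a subset of a linear subspace `W`, in units of the covolume of the lattice of
integer points of `W`. (The quotient does not depend on the choice of the Haar measure on `W`.) -/
noncomputable def latticeVolume [Fintype E] (W : Submodule ℝ (E → ℝ)) (S : Set W) : ℝ :=
  (MeasureTheory.Measure.addHaar : MeasureTheory.Measure W).real S /
    ZLattice.covolume (integerPoints W) (MeasureTheory.Measure.addHaar : MeasureTheory.Measure W)

/-- The normalized volume of a `d`-dimensional set `Δ` within its affine span, where `x` is a point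
of that span: `d!` times the lattice volume of the translate `Δ - x` in the linear subspace parallel
to the span. -/
noncomputable def normalizedVolume [Fintype E] (Δ : Set (E → ℝ)) (x : E → ℝ) : ℝ :=
  (Module.finrank ℝ (vectorSpan ℝ Δ)).factorial *
    latticeVolume (vectorSpan ℝ Δ) {w | x + (w : E → ℝ) ∈ Δ}

/-- A lattice triangulation is unimodular if each (nonempty) simplex has normalized volume `1`
within its affine span. -/
structure IsUnimodularTriangulation [Fintype E] (P : Set (E → ℝ)) (T : Set (Set (E → ℝ))) : Prop
    extends IsLatticeTriangulation P T where
  normalizedVolume_eq_one : ∀ Δ ∈ T, ∀ x ∈ Δ, normalizedVolume Δ x = 1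

end Triangulation

/-!
The orders of the framing turn a flow on the augmented graph into a family of routes: at each vertex
the edges are stacked as intervals whose lengths are their flows, and each point of an interval
follows the edge at its height at the next vertex. The lengths of the sets of points with a common
route are nonnegative weights on pairwise compatible routes. Conversely, compatible weights are
recovered in this way from the flow that they sum to, because at each edge compatible routes come
in the same order at both ends. So flows correspond to weights on route-cliques, and integer flows
to integer weights.

By Hall's theorem every nonzero weight family with the right totals at the sources and sinks
contains a layering. Subtracting the least one as far as possible, and repeating this, writes the
weights as a positive combination over a layering-simplex. The conditions on layering-simplices say
that every such combination arises from this greedy procedure, so the layering-simplex and its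
coefficients are unique, and integral for integral weights.

Hence each point of the flow polytope lies in the relative interior of exactly one of the simplices,
and the edge vectors of a simplex at a vertex form a basis of the integer points in its direction.
-/

/-! ### Lexicographic comparison of lists -/

/-- Strict lexicographic comparison of lists with respect to `r`. Unlike for `List.Lex`, a proper
prefix is not smaller: the lists must differ at a position that both of them have. -/
def LexLT {E : Type*} (r : E → E → Prop) (p q : List E) : Prop :=
  ∃ σ f g p' q', p = σ ++ f :: p' ∧ q = σ ++ g :: q' ∧ r f g

namespace LexLT

variable {E : Type*} {r : E → E → Prop}

theorem not_nil_left (q : List E) : ¬ LexLT r [] q := by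
  rintro ⟨σ, f, g, p', q', h, -⟩
  simp at h

theorem not_nil_right (p : List E) : ¬ LexLT r p [] := by
  rintro ⟨σ, f, g, p', q', -, h, -⟩
  simp at h

theorem cons_iff {x y : E} {p q : List E} :
    LexLT r (x :: p) (y :: q) ↔ r x y ∨ (x = y ∧ LexLT r p q) := by
  constructor
  · rintro ⟨σ, f, g, p', q', hp, hq, h⟩
    cases σ with
    | nil =>
      simp only [List.nil_append, List.cons.injEq] at hp hq
      rw [hp.1, hq.1]
      exact Or.inl h
    | cons z σ =>
      simp only [List.cons_append, List.cons.injEq] at hp hq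
      exact Or.inr ⟨hp.1.trans hq.1.symm, σ, f, g, p', q', hp.2, hq.2, h⟩
  · rintro (h | ⟨rfl, σ, f, g, p', q', rfl, rfl, h⟩)
    · exact ⟨[], x, y, p, q, rfl, rfl, h⟩
    · exact ⟨x :: σ, f, g, p', q', rfl, rfl, h⟩

theorem append_left (l : List E) {p q : List E} (h : LexLT r p q) : LexLT r (l ++ p) (l ++ q) := by
  obtain ⟨σ, f, g, p', q', rfl, rfl, h⟩ := h
  exact ⟨l ++ σ, f, g, p', q', by simp, by simp, h⟩

theorem irrefl (hr : ∀ e, ¬ r e e) (p : List E) : ¬ LexLT r p p := by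
  induction p with
  | nil => exact not_nil_left _
  | cons e p ih =>
    rw [cons_iff]
    rintro (h | ⟨-, h⟩)
    · exact hr _ h
    · exact ih h

theorem trans (hr : ∀ e f g, r e f → r f g → r e g) {p q s : List E}
    (h : LexLT r p q) (h' : LexLT r q s) : LexLT r p s := by
  induction p generalizing q s with
  | nil => exact (not_nil_left _ h).elim
  | cons e p ih =>
    cases q with
    | nil => exact (not_nil_right _ h).elim
    | cons f q =>
      cases s with
      | nil => exact (not_nil_right _ h').elim
      | cons g s =>
        rw [cons_iff] at h h' ⊢
        rcases h with h | ⟨rfl, h⟩ <;> rcases h' with h' | ⟨rfl, h'⟩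
        · exact Or.inl (hr _ _ _ h h')
        · exact Or.inl h
        · exact Or.inl h'
        · exact Or.inr ⟨rfl, ih h h'⟩

end LexLT

/-! ### Paths in directed acyclic graphs -/

namespace MultiDigraph

variable {V E : Type*} {G : MultiDigraph V E}

/-- The graph with all edges reversed, through which statements about heads follow from those about
tails. -/
def reverse (G : MultiDigraph V E) : MultiDigraph V E where
  tail := G.head
  head := G.tail

theorem isPath_append {u v : V} {l₁ l₂ : List E} :
    G.IsPath u (l₁ ++ l₂) v ↔ ∃ w, G.IsPath u l₁ w ∧ G.IsPath w l₂ v := by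
  induction l₁ generalizing u with
  | nil => simp [IsPath]
  | cons e l ih => simp [IsPath, ih, and_assoc]

theorem IsPath.reverse {u v : V} {l : List E} (h : G.IsPath u l v) :
    G.reverse.IsPath v l.reverse u := by
  induction l generalizing u with
  | nil => exact Eq.symm h
  | cons e l ih =>
    rw [List.reverse_cons, isPath_append]
    exact ⟨G.head e, ih h.2, rfl, h.1⟩

theorem IsPath.finish_unique {u v w : V} {l : List E} (h : G.IsPath u l v) (h' : G.IsPath u l w) :
    v = w := by
  induction l generalizing u with
  | nil => exact (Eq.symm h).trans h'
  | cons e l ih => exact ih h.2 h'.2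

theorem IsDAG.reverse (hG : G.IsDAG) : G.reverse.IsDAG := fun v l h =>
  List.reverse_eq_nil_iff.1 (hG v l.reverse h.reverse)

theorem IsDAG.eq_nil (hG : G.IsDAG) {u v : V} {l l' : List E} (h : G.IsPath u l v)
    (h' : G.IsPath v l' u) : l = [] :=
  (List.append_eq_nil_iff.1 (hG u (l ++ l') (isPath_append.2 ⟨v, h, h'⟩))).1

theorem IsDAG.nodup (hG : G.IsDAG) {u v : V} {l : List E} (h : G.IsPath u l v) : l.Nodup := by
  induction l generalizing u with
  | nil => exact List.nodup_nil
  | cons e l ih =>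
    refine List.nodup_cons.2 ⟨fun he => ?_, ih h.2⟩
    obtain ⟨l₁, l₂, rfl⟩ := List.append_of_mem he
    obtain ⟨w, h₁, h₂⟩ := isPath_append.1 h.2
    have := hG.eq_nil (l := [e]) (u := G.tail e) ⟨rfl, rfl⟩ (h₂.1 ▸ h₁)
    simp at this

theorem IsDAG.split_unique (hG : G.IsDAG) {u v w : V} {l₁ l₂ l₁' l₂' : List E}
    (h : l₁ ++ l₂ = l₁' ++ l₂') (h₁ : G.IsPath u l₁ w) (h₁' : G.IsPath u l₁' w)
    (h₂ : G.IsPath w l₂ v) (h₂' : G.IsPath w l₂' v) : l₁ = l₁' ∧ l₂ = l₂' := by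
  rcases List.append_eq_append_iff.1 h with ⟨m, rfl, rfl⟩ | ⟨m, rfl, rfl⟩
  · obtain ⟨x, hx, hx'⟩ := isPath_append.1 h₁'
    obtain rfl := h₁.finish_unique hx
    obtain rfl := hG _ _ hx'
    simp
  · obtain ⟨x, hx, hx'⟩ := isPath_append.1 h₁
    obtain rfl := h₁'.finish_unique hx
    obtain rfl := hG _ _ hx'
    simp

theorem IsDAG.induction [Finite V] (hG : G.IsDAG) {P : V → Prop}
    (h : ∀ v, (∀ e, G.tail e = v → P (G.head e)) → P v) (v : V) : P v := by
  let r : V → V → Prop := fun w v => ∃ l, l ≠ [] ∧ G.IsPath v l w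
  have : IsTrans V r := ⟨by
    rintro a b c ⟨l, hl, h⟩ ⟨l', -, h'⟩
    exact ⟨l' ++ l, by simp [hl], isPath_append.2 ⟨b, h', h⟩⟩⟩
  have : Std.Irrefl r := ⟨fun v ⟨l, hl, h⟩ => hl (hG v l h)⟩
  have wf := Finite.wellFounded_of_trans_of_irrefl r
  induction v using wf.induction with
  | h v ih => exact h v fun e he => ih _ ⟨[e], by simp, he, rfl⟩

/-- The route traversed backwards, as a route of the reversed graph. -/
def Route.reverse (p : G.Route) : G.reverse.Route where
  start := p.finish
  finish := p.start
  edges := p.edges.reverse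
  isPath := p.isPath.reverse
  isSource_start := p.isSink_finish
  isSink_finish := p.isSource_start

theorem Route.ext_of_start {p q : G.Route} (hs : p.start = q.start) (h : p.edges = q.edges) :
    p = q :=
  Route.ext hs (p.isPath.finish_unique (h ▸ hs ▸ q.isPath)) h

theorem Route.ext_edges {p q : G.Route} (hp : p.edges ≠ []) (h : p.edges = q.edges) : p = q := by
  refine Route.ext_of_start ?_ h
  obtain ⟨e, l, he⟩ := List.exists_cons_of_ne_nil hp
  have hp' := p.isPath
  have hq' := q.isPath
  rw [he] at hp'
  rw [← h, he] at hq'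
  exact hp'.1.symm.trans hq'.1

theorem IsDAG.finite_route [Finite V] [Finite E] (hG : G.IsDAG) : Finite G.Route := by
  classical
  have := Fintype.ofFinite E
  refine Finite.of_injective
    (fun p : G.Route => (p.start, (⟨p.edges, hG.nodup p.isPath⟩ : {l : List E // l.Nodup})))
    fun p q h => ?_
  simp only [Prod.mk.injEq, Subtype.mk.injEq] at h
  exact Route.ext_of_start h.1 h.2

theorem isPath_append_cons {u v : V} {l₁ l₂ : List E} {e : E} :
    G.IsPath u (l₁ ++ e :: l₂) v ↔ G.IsPath u l₁ (G.tail e) ∧ G.IsPath (G.head e) l₂ v := by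
  rw [isPath_append]
  exact ⟨fun ⟨_, h₁, h, h₂⟩ => ⟨h ▸ h₁, h₂⟩, fun ⟨h₁, h₂⟩ => ⟨_, h₁, rfl, h₂⟩⟩

theorem IsDAG.eq_of_tail_eq (hG : G.IsDAG) {u v : V} {l : List E} (h : G.IsPath u l v) {e f : E}
    (he : e ∈ l) (hf : f ∈ l) (hef : G.tail e = G.tail f) : e = f := by
  obtain ⟨l₁, l₂, rfl⟩ := List.append_of_mem he
  obtain ⟨m₁, m₂, hm⟩ := List.append_of_mem hf
  obtain ⟨h₁, h₂⟩ := isPath_append_cons.1 h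
  obtain ⟨h₁', h₂'⟩ := isPath_append_cons.1 (hm ▸ h)
  exact (List.cons.inj (hG.split_unique hm h₁ (hef ▸ h₁') ⟨rfl, h₂⟩ ⟨hef.symm, h₂'⟩).2).1

theorem IsDAG.eq_of_head_eq (hG : G.IsDAG) {u v : V} {l : List E} (h : G.IsPath u l v) {e f : E}
    (he : e ∈ l) (hf : f ∈ l) (hef : G.head e = G.head f) : e = f :=
  hG.reverse.eq_of_tail_eq h.reverse (List.mem_reverse.2 he) (List.mem_reverse.2 hf) hef

theorem IsDAG.split_unique_at_edge (hG : G.IsDAG) {u v : V} {l l₁ l₂ m₁ m₂ : List E} {e : E}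
    (h : G.IsPath u l v) (hl : l = l₁ ++ e :: l₂) (hm : l = m₁ ++ e :: m₂) :
    l₁ = m₁ ∧ l₂ = m₂ := by
  obtain ⟨h₁, h₂⟩ := isPath_append_cons.1 (hl ▸ h)
  obtain ⟨h₁', h₂'⟩ := isPath_append_cons.1 (hm ▸ h)
  obtain ⟨rfl, h'⟩ := hG.split_unique (hl.symm.trans hm) h₁ h₁' ⟨rfl, h₂⟩ ⟨rfl, h₂'⟩
  exact ⟨rfl, (List.cons.inj h').2⟩

theorem Route.exists_cons_of_append {p : G.Route} {l₁ l₂ : List E} {e : E}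
    (hp : p.edges = l₁ ++ e :: l₂) (h : ¬ G.IsSink (G.head e)) :
    ∃ f l, l₂ = f :: l ∧ G.tail f = G.head e := by
  obtain ⟨-, h₂⟩ := isPath_append_cons.1 (hp ▸ p.isPath)
  cases l₂ with
  | nil => exact (h (h₂ ▸ p.isSink_finish)).elim
  | cons f l => exact ⟨f, l, rfl, h₂.1⟩

end MultiDigraph

/-! ### Stacking the weights of the fibres of a map -/

/-- `r` is a strict total order on each fibre of `t`, and relates no elements of different fibres.
The framing gives such orders on the edges, with `t` the tail or the head. -/
structure IsFiberOrder {V E : Type*} (t : E → V) (r : E → E → Prop) : Prop where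
  eq_of_lt : ∀ e f, r e f → t e = t f
  irrefl : ∀ e, ¬ r e e
  trans : ∀ e f g, r e f → r f g → r e g
  total : ∀ e f, t e = t f → e = f ∨ r e f ∨ r f e

open Classical in
/-- The total weight of the elements below `e`: when intervals of lengths `F` are stacked upon each
other in the order `r`, the one of `e` is `[offset r F e, offset r F e + F e)`. -/
noncomputable def offset {E : Type*} [Fintype E] (r : E → E → Prop) (F : E → ℝ) (e : E) : ℝ :=
  ∑ g with r g e, F g

namespace IsFiberOrder

variable {V E : Type*} {t : E → V} {r : E → E → Prop}

theorem exists_minimal [Finite E] (h : IsFiberOrder t r) {D : Set E} (hD : D.Nonempty) :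
    ∃ m ∈ D, ∀ e ∈ D, ¬ r e m :=
  have : IsTrans E r := ⟨h.trans⟩
  have : Std.Irrefl r := ⟨h.irrefl⟩
  (Finite.wellFounded_of_trans_of_irrefl r).has_min D hD

theorem flip (h : IsFiberOrder t r) : IsFiberOrder t fun e f => r f e where
  eq_of_lt e f hef := (h.eq_of_lt f e hef).symm
  irrefl := h.irrefl
  trans e f g hef hfg := h.trans g f e hfg hef
  total e f hef := (h.total e f hef).imp_right Or.symm

variable [Fintype E] {F : E → ℝ}

theorem offset_nonneg (hF : ∀ e, 0 ≤ F e) (e : E) : 0 ≤ offset r F e :=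
  Finset.sum_nonneg fun _ _ => hF _

theorem offset_add_le_sum_of_mem (h : IsFiberOrder t r) (hF : ∀ e, 0 ≤ F e) {D : Finset E} {e : E}
    (he : e ∈ D) (hD : ∀ g, r g e → g ∈ D) : offset r F e + F e ≤ ∑ g ∈ D, F g := by
  classical
  have hbelow : e ∉ Finset.univ.filter fun g => r g e := by simpa using h.irrefl e
  rw [offset, add_comm, ← Finset.sum_insert hbelow]
  refine Finset.sum_le_sum_of_subset_of_nonneg (Finset.insert_subset he fun g hg => ?_)
    fun _ _ _ => hF _
  exact hD g (Finset.mem_filter.1 hg).2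

theorem offset_add_le (h : IsFiberOrder t r) (hF : ∀ e, 0 ≤ F e) {g e : E} (hge : r g e) :
    offset r F g + F g ≤ offset r F e := by
  classical
  exact h.offset_add_le_sum_of_mem hF (by simpa using hge)
    fun x hx => by simpa using h.trans _ _ _ hx hge

open Classical in
theorem offset_add_le_sum (h : IsFiberOrder t r) (hF : ∀ e, 0 ≤ F e) (e : E) :
    offset r F e + F e ≤ ∑ g with t g = t e, F g :=
  h.offset_add_le_sum_of_mem hF (by simp) fun g hg => by simpa using h.eq_of_lt _ _ hg

theorem eq_of_mem_Ico (h : IsFiberOrder t r) (hF : ∀ e, 0 ≤ F e) {e f : E} (hef : t e = t f)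
    {y : ℝ} (he : offset r F e ≤ y ∧ y < offset r F e + F e)
    (hf : offset r F f ≤ y ∧ y < offset r F f + F f) : e = f := by
  rcases h.total e f hef with h' | h' | h'
  · exact h'
  · linarith [h.offset_add_le hF h']
  · linarith [h.offset_add_le hF h']

theorem exists_sum_eq_offset_add (h : IsFiberOrder t r) {D : Finset E} (hne : D.Nonempty) {v : V}
    (hv : ∀ e ∈ D, t e = v) (hlower : ∀ e ∈ D, ∀ g, r g e → g ∈ D) :
    ∃ m ∈ D, ∑ e ∈ D, F e = offset r F m + F m := by
  classical
  obtain ⟨m, hm, hmax⟩ := h.flip.exists_minimal (D := D) hne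
  have hbelow : Finset.univ.filter (fun e => r e m) = D.erase m := by
    ext e
    simp only [Finset.mem_filter, Finset.mem_univ, true_and, Finset.mem_erase]
    refine ⟨fun hem => ⟨fun he => h.irrefl m (he ▸ hem), hlower m hm e hem⟩, fun ⟨hne, he⟩ => ?_⟩
    exact ((h.total e m ((hv e he).trans (hv m hm).symm)).resolve_left hne).resolve_right
      (hmax e he)
  exact ⟨m, hm, by rw [offset, hbelow, Finset.sum_erase_add _ _ hm]⟩

open Classical in
theorem exists_mem_Ico (h : IsFiberOrder t r) {v : V} {y : ℝ} (hy : 0 ≤ y)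
    (hlt : y < ∑ e with t e = v, F e) :
    ∃ e, t e = v ∧ offset r F e ≤ y ∧ y < offset r F e + F e := by
  obtain ⟨top, htop, hsum⟩ := h.exists_sum_eq_offset_add (F := F)
    (Finset.nonempty_of_sum_ne_zero (hy.trans_lt hlt).ne') (v := v) (by simp)
    fun e he g hg => by simpa [h.eq_of_lt _ _ hg] using he
  obtain ⟨e, ⟨hev, hye⟩, hmin⟩ := h.exists_minimal (D := {e | t e = v ∧ y < offset r F e + F e})
    ⟨top, by simpa using htop, hsum ▸ hlt⟩
  refine ⟨e, hev, not_lt.1 fun hlt' => ?_, hye⟩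
  obtain ⟨g, hg, hsum'⟩ := h.exists_sum_eq_offset_add (F := F)
    (Finset.nonempty_of_sum_ne_zero (hy.trans_lt hlt').ne') (v := v)
    (fun g hg => (h.eq_of_lt _ _ (Finset.mem_filter.1 hg).2).trans hev)
    (fun f hf g hg => by simpa using h.trans _ _ _ hg (Finset.mem_filter.1 hf).2)
  have hge : r g e := (Finset.mem_filter.1 hg).2
  exact hmin g ⟨(h.eq_of_lt _ _ hge).trans hev, hsum' ▸ hlt'⟩ hge

end IsFiberOrder

/-! ### Points that follow the edges of a list

A flow `F` lets the points of an interval of length `F e` move along the edge `e`. At each vertex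
the incoming and the outgoing edges are stacked in their order, and a point of an incoming edge goes
on along the outgoing edge at the same height. -/

section Follows

variable {E : Type*}

/-- The point at height `y` follows the edges of the list, where the edge `e` has width `F e` and
lies above the height `tl e` at its tail and above the height `hd e` at its head. -/
def Follows (tl hd F : E → ℝ) : ℝ → List E → Prop
  | _, [] => True
  | y, e :: l => (tl e ≤ y ∧ y < tl e + F e) ∧ Follows tl hd F (y - tl e + hd e) l

/-- The change of height along a list of edges. -/
def drift (tl hd : E → ℝ) (l : List E) : ℝ := (l.map fun e => hd e - tl e).sum

/-- The amount of flow that follows the edges of the list. -/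
noncomputable def followWeight (tl hd F : E → ℝ) (l : List E) : ℝ :=
  MeasureTheory.volume.real {y | Follows tl hd F y l}

variable {tl hd F : E → ℝ}

theorem add_drift_cons (y : ℝ) (e : E) (l : List E) :
    y + drift tl hd (e :: l) = y - tl e + hd e + drift tl hd l := by
  simp only [drift, List.map_cons, List.sum_cons]
  ring

theorem drift_reverse_swap (l : List E) : drift hd tl l.reverse = -drift tl hd l := by
  simp only [drift, List.map_reverse, List.sum_reverse, List.sum_neg, List.map_map]
  congr 2
  ext
  simp

theorem follows_append {y : ℝ} {l₁ l₂ : List E} :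
    Follows tl hd F y (l₁ ++ l₂) ↔
      Follows tl hd F y l₁ ∧ Follows tl hd F (y + drift tl hd l₁) l₂ := by
  induction l₁ generalizing y with
  | nil => simp [Follows, drift]
  | cons e l ih => simp [Follows, ih, add_drift_cons, and_assoc]

theorem follows_reverse {y : ℝ} {l : List E} :
    Follows hd tl F (y + drift tl hd l) l.reverse ↔ Follows tl hd F y l := by
  induction l generalizing y with
  | nil => simp [Follows]
  | cons e l ih =>
    rw [List.reverse_cons, follows_append, add_drift_cons, ih, drift_reverse_swap]
    simp only [Follows, and_true]
    constructor
    · rintro ⟨h, h', h''⟩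
      exact ⟨⟨by linarith, by linarith⟩, h⟩
    · rintro ⟨⟨h', h''⟩, h⟩
      exact ⟨h, by linarith, by linarith⟩

theorem setOf_follows_cons_eq_Ico {e : E} {l : List E} {lo hi : ℝ}
    (h : {y | Follows tl hd F y l} = Set.Ico lo hi) :
    {y | Follows tl hd F y (e :: l)} =
      Set.Ico (max (tl e) (lo + tl e - hd e)) (min (tl e + F e) (hi + tl e - hd e)) := by
  ext y
  have hl : Follows tl hd F (y - tl e + hd e) l ↔ lo ≤ y - tl e + hd e ∧ y - tl e + hd e < hi :=
    Set.ext_iff.1 h _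
  simp only [Set.mem_ofPred_eq, Follows, hl, Set.mem_Ico, max_le_iff, lt_min_iff]
  constructor
  · rintro ⟨⟨h₁, h₂⟩, h₃, h₄⟩
    exact ⟨⟨h₁, by linarith⟩, h₂, by linarith⟩
  · rintro ⟨⟨h₁, h₃⟩, h₂, h₄⟩
    exact ⟨⟨h₁, h₂⟩, by linarith, by linarith⟩

theorem exists_setOf_follows_eq_Ico {H : AddSubgroup ℝ} (htl : ∀ e, tl e ∈ H) (hhd : ∀ e, hd e ∈ H)
    (hF : ∀ e, F e ∈ H) {l : List E} (hl : l ≠ []) :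
    ∃ lo ∈ H, ∃ hi ∈ H, {y | Follows tl hd F y l} = Set.Ico lo hi := by
  induction l with
  | nil => exact (hl rfl).elim
  | cons e l ih =>
    by_cases hl' : l = []
    · exact ⟨tl e, htl e, tl e + F e, H.add_mem (htl e) (hF e), by ext; simp [hl', Follows]⟩
    · obtain ⟨lo, hlo, hi, hhi, h⟩ := ih hl'
      have hshift : ∀ x ∈ H, x + tl e - hd e ∈ H := fun x hx =>
        H.sub_mem (H.add_mem hx (htl e)) (hhd e)
      exact ⟨_, max_rec' (· ∈ H) (htl e) (hshift lo hlo), _,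
        min_rec' (· ∈ H) (H.add_mem (htl e) (hF e)) (hshift hi hhi), setOf_follows_cons_eq_Ico h⟩

-- The set of followers of the empty path is `ℝ`, whose infinite volume has the real value `0`.
theorem followWeight_nil : followWeight tl hd F [] = 0 := by
  simp [followWeight, Follows, MeasureTheory.measureReal_def]

theorem followWeight_mem {H : AddSubgroup ℝ} (htl : ∀ e, tl e ∈ H) (hhd : ∀ e, hd e ∈ H)
    (hF : ∀ e, F e ∈ H) (l : List E) : followWeight tl hd F l ∈ H := by
  by_cases hl : l = []
  · rw [hl, followWeight_nil]
    exact H.zero_mem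
  · obtain ⟨lo, hlo, hi, hhi, h⟩ := exists_setOf_follows_eq_Ico htl hhd hF hl
    rw [followWeight, h, Real.volume_real_Ico]
    exact max_rec' (· ∈ H) (H.sub_mem hhi hlo) H.zero_mem

theorem measurableSet_follows {l : List E} (hl : l ≠ []) :
    MeasurableSet {y | Follows tl hd F y l} := by
  obtain ⟨lo, -, hi, -, h⟩ := exists_setOf_follows_eq_Ico (tl := tl) (hd := hd) (F := F) (H := ⊤)
    (by simp) (by simp) (by simp) hl
  exact h ▸ measurableSet_Ico

theorem volume_follows_ne_top {l : List E} (hl : l ≠ []) :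
    MeasureTheory.volume {y | Follows tl hd F y l} ≠ ⊤ := by
  obtain ⟨lo, -, hi, -, h⟩ := exists_setOf_follows_eq_Ico (tl := tl) (hd := hd) (F := F) (H := ⊤)
    (by simp) (by simp) (by simp) hl
  exact h ▸ measure_Ico_lt_top.ne

theorem followWeight_nonneg (l : List E) : 0 ≤ followWeight tl hd F l :=
  MeasureTheory.measureReal_nonneg

theorem exists_follows_of_followWeight_ne_zero {l : List E} (h : followWeight tl hd F l ≠ 0) :
    ∃ y, Follows tl hd F y l :=
  MeasureTheory.nonempty_of_measureReal_ne_zero h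

end Follows

/-! ### The noncrossing decomposition of a flow into routes -/

section Crosses

variable {E : Type*} {r s : E → E → Prop}

/-- `p` enters a common subpath of `p` and `q` by a smaller edge than `q`, but leaves it by a larger
one, where `r` is the order on outgoing edges and `s` the order on incoming edges. -/
def Crosses (r s : E → E → Prop) (p q : List E) : Prop :=
  ∃ σ f g f' g' p' p'' q' q'', p = p' ++ f :: (σ ++ f' :: p'') ∧ q = q' ++ g :: (σ ++ g' :: q'') ∧
    s f g ∧ r g' f'

theorem Crosses.reverse {p q : List E} (h : Crosses r s p q) :
    Crosses s r q.reverse p.reverse := by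
  obtain ⟨σ, f, g, f', g', p', p'', q', q'', rfl, rfl, hfg, hgf⟩ := h
  exact ⟨σ.reverse, g', f', g, f, q''.reverse, q'.reverse, p''.reverse, p'.reverse, by simp,
    by simp, hgf, hfg⟩

theorem crosses_of_lexLT {p₁ p₂ q₁ q₂ : List E} (h₁ : LexLT s p₁.reverse q₁.reverse)
    (h₂ : LexLT r q₂ p₂) : Crosses r s (p₁ ++ p₂) (q₁ ++ q₂) := by
  obtain ⟨τ, f, g, p', q', hp, hq, hfg⟩ := h₁
  obtain ⟨ρ, g', f', q'', p'', rfl, rfl, hfg'⟩ := h₂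
  rw [List.reverse_eq_iff] at hp hq
  subst hp hq
  exact ⟨τ.reverse ++ ρ, f, g, f', g', p'.reverse, p'', q'.reverse, q'', by simp, by simp, hfg,
    hfg'⟩

end Crosses

namespace MultiDigraph

variable {V E : Type*} {G : MultiDigraph V E} {r s : E → E → Prop}

/-- No two routes of `R` cross. For the orders of a framing these are the route-cliques. -/
def IsNoncrossing (r s : E → E → Prop) (R : Set G.Route) : Prop :=
  ∀ p ∈ R, ∀ q ∈ R, ¬ Crosses r s p.edges q.edges

/-- The heights, at the tail of `e`, of the points that follow the route `p`. -/
def Route.heightsAt (tl hd F : E → ℝ) (p : G.Route) (e : E) : Set ℝ :=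
  {y | ∃ l₁ l₂, p.edges = l₁ ++ e :: l₂ ∧
    Follows hd tl F y l₁.reverse ∧ Follows tl hd F y (e :: l₂)}

theorem Route.heightsAt_eq_preimage (hG : G.IsDAG) {p : G.Route} {e : E} {l₁ l₂ : List E}
    (hp : p.edges = l₁ ++ e :: l₂) (tl hd F : E → ℝ) :
    p.heightsAt tl hd F e = (· + -drift tl hd l₁) ⁻¹' {y | Follows tl hd F y p.edges} := by
  ext y
  simp only [Set.mem_preimage, Set.mem_ofPred_eq, hp, follows_append, neg_add_cancel_right]
  rw [← follows_reverse (tl := tl), neg_add_cancel_right]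
  refine ⟨fun ⟨m₁, m₂, hm, h₁, h₂⟩ => ?_, fun ⟨h₁, h₂⟩ => ⟨l₁, l₂, hp, h₁, h₂⟩⟩
  obtain ⟨rfl, rfl⟩ := hG.split_unique_at_edge p.isPath hp hm
  exact ⟨h₁, h₂⟩

theorem Route.volume_heightsAt (hG : G.IsDAG) {p : G.Route} {e : E} (he : e ∈ p.edges)
    (tl hd F : E → ℝ) : MeasureTheory.volume (p.heightsAt tl hd F e) =
      MeasureTheory.volume {y | Follows tl hd F y p.edges} := by
  obtain ⟨l₁, l₂, hp⟩ := List.append_of_mem he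
  rw [heightsAt_eq_preimage hG hp, MeasureTheory.measure_preimage_add_right]

theorem Route.measurableSet_heightsAt (hG : G.IsDAG) {p : G.Route} {e : E} (he : e ∈ p.edges)
    (tl hd F : E → ℝ) : MeasurableSet (p.heightsAt tl hd F e) := by
  obtain ⟨l₁, l₂, hp⟩ := List.append_of_mem he
  rw [heightsAt_eq_preimage hG hp]
  exact (measurableSet_follows (List.ne_nil_of_mem he)).preimage (measurable_id.add_const _)

open Classical in
/-- The flow that is the sum of the routes with the given weights. -/
noncomputable def routeFlow [Fintype G.Route] (c : G.Route → ℝ) (e : E) : ℝ :=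
  ∑ p with e ∈ p.edges, c p

variable [Fintype E] {F : E → ℝ}

/-- The part of the flow `F` that follows the route `p` when the edges are stacked in the order `r`
at their tails and in the order `s` at their heads. -/
noncomputable def Route.carriedFlow (r s : E → E → Prop) (F : E → ℝ) (p : G.Route) : ℝ :=
  followWeight (offset r F) (offset s F) F p.edges

open Classical in
/-- Flow conservation at the inner vertices. -/
def IsConserved (G : MultiDigraph V E) (F : E → ℝ) : Prop :=
  ∀ v, ¬ G.IsSource v → ¬ G.IsSink v → ∑ e with G.head e = v, F e = ∑ e with G.tail e = v, F e

theorem IsConserved.reverse (h : G.IsConserved F) : G.reverse.IsConserved F :=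
  fun v h₁ h₂ => (h v h₂ h₁).symm

theorem exists_follows [Finite V] (hG : G.IsDAG) (hr : IsFiberOrder G.tail r)
    (hs : IsFiberOrder G.head s) (hF : ∀ e, 0 ≤ F e) (hc : G.IsConserved F) (e : E) {y : ℝ}
    (hy : offset r F e ≤ y ∧ y < offset r F e + F e) :
    ∃ l v, G.IsPath (G.head e) l v ∧ G.IsSink v ∧
      Follows (offset r F) (offset s F) F y (e :: l) := by
  induction hv : G.tail e using hG.induction generalizing e y with
  | h v ih =>
    by_cases hsink : G.IsSink (G.head e)
    · exact ⟨[], G.head e, rfl, hsink, hy, trivial⟩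
    · have hle := hs.offset_add_le_sum hF e
      rw [hc (G.head e) (fun h => h e rfl) hsink] at hle
      have hnonneg := IsFiberOrder.offset_nonneg (r := s) hF e
      obtain ⟨f, hf, hfy⟩ := hr.exists_mem_Ico (v := G.head e)
        (y := y - offset r F e + offset s F e) (by linarith) (by linarith)
      obtain ⟨l, w, hl, hw, hfol⟩ := ih e hv f hfy hf
      exact ⟨f :: l, w, ⟨hf, hl⟩, hw, hy, hfol⟩

theorem follows_unique (hr : IsFiberOrder G.tail r) (hF : ∀ e, 0 ≤ F e) {hd : E → ℝ}
    {u v w : V} {l m : List E} (hl : G.IsPath u l v) (hm : G.IsPath u m w) (hv : G.IsSink v)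
    (hw : G.IsSink w) {y : ℝ} (hyl : Follows (offset r F) hd F y l)
    (hym : Follows (offset r F) hd F y m) : l = m := by
  induction l generalizing u m y with
  | nil =>
    cases m with
    | nil => rfl
    | cons f m => exact (hv f (hm.1.trans hl)).elim
  | cons e l ih =>
    cases m with
    | nil => exact (hw e (hl.1.trans hm)).elim
    | cons f m =>
      obtain rfl := hr.eq_of_mem_Ico hF (hl.1.trans hm.1.symm) hyl.1 hym.1
      rw [ih hl.2 hm.2 hyl.2 hym.2]

theorem not_crosses_of_follows (hr : IsFiberOrder G.tail r) (hs : IsFiberOrder G.head s)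
    (hF : ∀ e, 0 ≤ F e) {p q : List E} {y z : ℝ} (hp : Follows (offset r F) (offset s F) F y p)
    (hq : Follows (offset r F) (offset s F) F z q) : ¬ Crosses r s p q := by
  rintro ⟨σ, f, g, f', g', p', p'', q', q'', rfl, rfl, hfg, hgf⟩
  rw [follows_append, Follows, follows_append, Follows] at hp hq
  have hin := hs.offset_add_le hF hfg
  have hout := hr.offset_add_le hF hgf
  obtain ⟨-, ⟨-, hp₂⟩, -, ⟨hp₃, -⟩, -⟩ := hp
  obtain ⟨-, ⟨hq₁, -⟩, -, ⟨-, hq₄⟩, -⟩ := hq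
  linarith

theorem isNoncrossing_support_carriedFlow (hr : IsFiberOrder G.tail r)
    (hs : IsFiberOrder G.head s) (hF : ∀ e, 0 ≤ F e) :
    IsNoncrossing r s (Function.support (Route.carriedFlow (G := G) r s F)) := by
  intro p hp q hq
  obtain ⟨y, hy⟩ := exists_follows_of_followWeight_ne_zero hp
  obtain ⟨z, hz⟩ := exists_follows_of_followWeight_ne_zero hq
  exact not_crosses_of_follows hr hs hF hy hz

theorem Route.eq_of_mem_heightsAt (hr : IsFiberOrder G.tail r) (hs : IsFiberOrder G.head s)
    (hF : ∀ e, 0 ≤ F e) {p q : G.Route} {e : E} {y : ℝ}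
    (hp : y ∈ p.heightsAt (offset r F) (offset s F) F e)
    (hq : y ∈ q.heightsAt (offset r F) (offset s F) F e) : p = q := by
  obtain ⟨p₁, p₂, hpe, hp₁, hp₂⟩ := hp
  obtain ⟨q₁, q₂, hqe, hq₁, hq₂⟩ := hq
  obtain ⟨hpath₁, hpath₂⟩ := isPath_append_cons.1 (hpe ▸ p.isPath)
  obtain ⟨hqath₁, hqath₂⟩ := isPath_append_cons.1 (hqe ▸ q.isPath)
  have hafter : p₂ = q₂ :=
    follows_unique hr hF hpath₂ hqath₂ p.isSink_finish q.isSink_finish hp₂.2 hq₂.2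
  have hbefore : p₁.reverse = q₁.reverse :=
    follows_unique (G := G.reverse) hs hF hpath₁.reverse hqath₁.reverse p.isSource_start
      q.isSource_start hp₁ hq₁
  refine Route.ext_edges (by simp [hpe]) ?_
  rw [hpe, hqe, hafter, List.reverse_injective hbefore]

theorem exists_mem_heightsAt [Finite V] (hG : G.IsDAG) (hr : IsFiberOrder G.tail r)
    (hs : IsFiberOrder G.head s) (hF : ∀ e, 0 ≤ F e) (hc : G.IsConserved F) {e : E} {y : ℝ}
    (hy : offset r F e ≤ y ∧ y < offset r F e + F e) :
    ∃ p : G.Route, y ∈ p.heightsAt (offset r F) (offset s F) F e := by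
  obtain ⟨l₂, w, h₂, hw, hf₂⟩ := exists_follows hG hr hs hF hc e hy
  obtain ⟨l₁, u, h₁, hu, -, hf₁⟩ := exists_follows (G := G.reverse) hG.reverse hs hr hF hc.reverse e
    (y := y - offset r F e + offset s F e) ⟨by linarith, by linarith⟩
  refine ⟨⟨u, w, l₁.reverse ++ e :: l₂, isPath_append_cons.2 ⟨h₁.reverse, h₂⟩, hu, hw⟩,
    l₁.reverse, l₂, rfl, ?_, hf₂⟩
  rwa [List.reverse_reverse, show y = y - offset r F e + offset s F e - offset s F e + offset r F e
    by ring]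

theorem routeFlow_carriedFlow [Finite V] [Fintype G.Route] (hG : G.IsDAG)
    (hr : IsFiberOrder G.tail r) (hs : IsFiberOrder G.head s) (hF : ∀ e, 0 ≤ F e)
    (hc : G.IsConserved F) (e : E) : routeFlow (Route.carriedFlow (G := G) r s F) e = F e := by
  classical
  let I : G.Route → Set ℝ := fun p => p.heightsAt (offset r F) (offset s F) F e
  have hunion : ⋃ p ∈ Finset.univ.filter fun p : G.Route => e ∈ p.edges, I p =
      Set.Ico (offset r F e) (offset r F e + F e) := by
    ext y
    simp only [Finset.mem_filter, Finset.mem_univ, true_and, Set.mem_iUnion, exists_prop]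
    refine ⟨fun ⟨_, _, _, _, _, _, h, _⟩ => h, fun hy => ?_⟩
    obtain ⟨p, l₁, l₂, hpe, hfol⟩ := exists_mem_heightsAt hG hr hs hF hc hy
    exact ⟨p, by simp [hpe], l₁, l₂, hpe, hfol⟩
  calc routeFlow (Route.carriedFlow r s F) e
      = ∑ p : G.Route with e ∈ p.edges, MeasureTheory.volume.real (I p) := by
        refine Finset.sum_congr (by congr) fun p hp => ?_
        rw [MeasureTheory.measureReal_def, Route.volume_heightsAt hG (Finset.mem_filter.1 hp).2]
        rfl
    _ = MeasureTheory.volume.real (⋃ p ∈ Finset.univ.filter fun p : G.Route => e ∈ p.edges, I p) :=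
        (MeasureTheory.measureReal_biUnion_finset
          (fun p _ q _ hpq => Set.disjoint_left.2 fun y hp hq =>
            hpq (Route.eq_of_mem_heightsAt hr hs hF hp hq))
          (fun p hp => Route.measurableSet_heightsAt hG (Finset.mem_filter.1 hp).2 _ _ _)
          (h := fun p hp => by
            have he := (Finset.mem_filter.1 hp).2
            exact Route.volume_heightsAt hG he _ _ _ ▸
              volume_follows_ne_top (List.ne_nil_of_mem he))).symm
    _ = F e := by rw [hunion, Real.volume_real_Ico, add_sub_cancel_left, max_eq_left (hF e)]

end MultiDigraph

/-! ### Uniqueness of the noncrossing decomposition -/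

namespace MultiDigraph

variable {V E : Type*} {G : MultiDigraph V E} {r s : E → E → Prop}

/-- The route `q` uses the edge `e`, and there it comes before a route that follows `p₁` before `e`
and `p₂` after `e`. -/
def Before (r s : E → E → Prop) (p₁ : List E) (e : E) (p₂ : List E) (q : G.Route) : Prop :=
  ∃ q₁ q₂, q.edges = q₁ ++ e :: q₂ ∧ (LexLT s q₁.reverse p₁.reverse ∨ LexLT r q₂ p₂)

theorem before_reverse {p₁ p₂ : List E} {e : E} {q : G.Route} :
    Before s r p₂.reverse e p₁.reverse q.reverse ↔ Before r s p₁ e p₂ q := by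
  constructor
  · rintro ⟨q₁, q₂, hq, h⟩
    refine ⟨q₂.reverse, q₁.reverse, ?_, by simpa using h.symm⟩
    simpa [Route.reverse] using congrArg List.reverse hq
  · rintro ⟨q₁, q₂, hq, h⟩
    exact ⟨q₂.reverse, q₁.reverse, by simp [Route.reverse, hq], by simpa using h.symm⟩

theorem before_next_of_before (hr : IsFiberOrder G.tail r) (hs : IsFiberOrder G.head s)
    {p q : G.Route} {p₁ p₂ : List E} {e f : E} (hp : p.edges = p₁ ++ e :: f :: p₂)
    (hqp : ¬ Crosses r s q.edges p.edges)
    (h : (∃ g ∈ q.edges, s g e) ∨ Before r s p₁ e (f :: p₂) q) :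
    (∃ g ∈ q.edges, r g f) ∨ Before r s (p₁ ++ [e]) f p₂ q := by
  have hpath := p.isPath
  rw [hp, isPath_append_cons] at hpath
  have hef : G.tail f = G.head e := hpath.2.1
  have hsink : ¬ G.IsSink (G.head e) := fun hsink => hsink f hef
  obtain ⟨q₁, g, f', q₂, hq, hf', hlex⟩ : ∃ q₁ g f' q₂, q.edges = q₁ ++ g :: f' :: q₂ ∧
      G.tail f' = G.head e ∧ (LexLT s (g :: q₁.reverse) (e :: p₁.reverse) ∨
        g = e ∧ LexLT r (f' :: q₂) (f :: p₂)) := by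
    rcases h with ⟨g, hg, hge⟩ | ⟨q₁, q₂, hq, hlex⟩
    · obtain ⟨q₁, q₂, hq⟩ := List.append_of_mem hg
      have hhead := hs.eq_of_lt _ _ hge
      obtain ⟨f', q₂, rfl, hf'⟩ := q.exists_cons_of_append hq (hhead ▸ hsink)
      exact ⟨q₁, g, f', q₂, hq, hf'.trans hhead, Or.inl (LexLT.cons_iff.2 (Or.inl hge))⟩
    · obtain ⟨f', q₂, rfl, hf'⟩ := q.exists_cons_of_append hq hsink
      exact ⟨q₁, e, f', q₂, hq, hf', hlex.imp (fun h => LexLT.append_left [e] h) (⟨rfl, ·⟩)⟩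
  have hq' : q.edges = (q₁ ++ [g]) ++ f' :: q₂ := by simp [hq]
  rcases hlex with hlex | ⟨rfl, hlex⟩
  · have hbefore : LexLT s (q₁ ++ [g]).reverse (p₁ ++ [e]).reverse := by simpa using hlex
    rcases hr.total f' f (hf'.trans hef.symm) with rfl | hlt | hgt
    · exact Or.inr ⟨q₁ ++ [g], q₂, hq', Or.inl hbefore⟩
    · exact Or.inl ⟨f', by simp [hq], hlt⟩
    · have hcross := crosses_of_lexLT hbefore
        (LexLT.cons_iff.2 (Or.inl hgt) : LexLT r (f :: p₂) (f' :: q₂))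
      exact (hqp (by simpa [hq, hp] using hcross)).elim
  · rcases LexLT.cons_iff.1 hlex with hlt | ⟨rfl, hlex'⟩
    · exact Or.inl ⟨f', by simp [hq], hlt⟩
    · exact Or.inr ⟨q₁ ++ [g], q₂, hq', Or.inr hlex'⟩

theorem before_iff_before_next (hr : IsFiberOrder G.tail r) (hs : IsFiberOrder G.head s)
    {p q : G.Route} {p₁ p₂ : List E} {e f : E} (hp : p.edges = p₁ ++ e :: f :: p₂)
    (hpq : ¬ Crosses r s p.edges q.edges) (hqp : ¬ Crosses r s q.edges p.edges) :
    ((∃ g ∈ q.edges, s g e) ∨ Before r s p₁ e (f :: p₂) q) ↔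
      ((∃ g ∈ q.edges, r g f) ∨ Before r s (p₁ ++ [e]) f p₂ q) := by
  refine ⟨before_next_of_before hr hs hp hqp, fun h => ?_⟩
  have hback := before_next_of_before (p := p.reverse) (q := q.reverse) (e := f) (f := e)
    (p₁ := p₂.reverse) (p₂ := p₁.reverse) hs hr (by simp [Route.reverse, hp])
    (fun h => hpq (by simpa [Route.reverse] using h.reverse))
  have hmem (g : E) : g ∈ q.reverse.edges ↔ g ∈ q.edges := List.mem_reverse
  simp only [hmem, ← List.reverse_cons, before_reverse,
    show e :: p₁.reverse = (p₁ ++ [e]).reverse by simp] at hback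
  exact hback h

theorem not_before_of_exists_mem {t : E → V} (hr : IsFiberOrder t r)
    (ht : ∀ q : G.Route, ∀ g ∈ q.edges, ∀ g' ∈ q.edges, t g = t g' → g = g') {r' s' : E → E → Prop}
    {e : E} {q : G.Route} (h : ∃ g ∈ q.edges, r g e) (p₁ p₂ : List E) :
    ¬ Before r' s' p₁ e p₂ q := by
  rintro ⟨q₁, q₂, hq, -⟩
  obtain ⟨g, hg, hge⟩ := h
  obtain rfl := ht q g hg e (by simp [hq]) (hr.eq_of_lt _ _ hge)
  exact hr.irrefl _ hge

open Classical in
theorem IsPath.sum_tail_sub_sum_head {u w : V} {l : List E} (h : G.IsPath u l w) (v : V) :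
    (l.map fun e => if G.tail e = v then (1 : ℝ) else 0).sum -
      (l.map fun e => if G.head e = v then (1 : ℝ) else 0).sum =
    (if u = v then 1 else 0) - if w = v then 1 else 0 := by
  induction l generalizing u with
  | nil => simp [show u = w from h]
  | cons e l ih =>
    have hih := ih h.2
    simp only [List.map_cons, List.sum_cons, h.1]
    linarith

variable [Fintype G.Route] {c : G.Route → ℝ}

open Classical in
theorem offset_routeFlow [Fintype E] {t : E → V} (hr : IsFiberOrder t r)
    (ht : ∀ q : G.Route, ∀ g ∈ q.edges, ∀ g' ∈ q.edges, t g = t g' → g = g') (e : E) :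
    offset r (routeFlow c) e = ∑ q with ∃ g ∈ q.edges, r g e, c q := by
  simp only [offset, routeFlow]
  rw [← Finset.sum_biUnion]
  · congr 1
    ext q
    simp only [Finset.mem_biUnion, Finset.mem_filter, Finset.mem_univ, true_and, and_comm]
  · intro g hg g' hg' hne
    simp only [Finset.coe_filter, Finset.mem_univ, true_and, Set.mem_ofPred_eq] at hg hg'
    refine Finset.disjoint_left.2 fun q hq hq' => hne ?_
    simp only [Finset.mem_filter, Finset.mem_univ, true_and] at hq hq'
    exact ht q g hq g' hq' ((hr.eq_of_lt _ _ hg).trans (hr.eq_of_lt _ _ hg').symm)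

open Classical in
/-- The total weight of the routes that come before a given one at the edge `e`. -/
noncomputable def position (r s : E → E → Prop) (c : G.Route → ℝ) (p₁ : List E) (e : E)
    (p₂ : List E) : ℝ :=
  ∑ q with Before r s p₁ e p₂ q, c q

theorem position_nonneg (hc : ∀ p, 0 ≤ c p) (p₁ : List E) (e : E) (p₂ : List E) :
    0 ≤ position r s c p₁ e p₂ :=
  Finset.sum_nonneg fun _ _ => hc _

theorem position_add_le (hG : G.IsDAG) (hr : ∀ e, ¬ r e e) (hs : ∀ e, ¬ s e e)
    (hc : ∀ p, 0 ≤ c p) {p : G.Route} {p₁ p₂ : List E} {e : E} (hp : p.edges = p₁ ++ e :: p₂) :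
    position r s c p₁ e p₂ + c p ≤ routeFlow c e := by
  classical
  have hnot : p ∉ Finset.univ.filter fun q => Before r s p₁ e p₂ q := by
    simp only [Finset.mem_filter, Finset.mem_univ, true_and]
    rintro ⟨q₁, q₂, hq, h⟩
    obtain ⟨rfl, rfl⟩ := hG.split_unique_at_edge p.isPath hp hq
    exact h.elim (LexLT.irrefl hs _) (LexLT.irrefl hr _)
  rw [position, add_comm, ← Finset.sum_insert hnot, routeFlow]
  refine Finset.sum_le_sum_of_subset_of_nonneg (fun q hq => ?_) fun _ _ _ => hc _
  simp only [Finset.mem_insert, Finset.mem_filter, Finset.mem_univ, true_and] at hq ⊢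
  rcases hq with rfl | ⟨q₁, q₂, hq, -⟩
  · simp [hp]
  · simp [hq]

theorem offset_add_position [Fintype E] (hG : G.IsDAG) (hr : IsFiberOrder G.tail r)
    (hs : IsFiberOrder G.head s) (hcross : IsNoncrossing r s (Function.support c)) {p : G.Route}
    (hp0 : c p ≠ 0) {p₁ p₂ : List E} {e f : E} (hp : p.edges = p₁ ++ e :: f :: p₂) :
    offset s (routeFlow c) e + position r s c p₁ e (f :: p₂) =
      offset r (routeFlow c) f + position r s c (p₁ ++ [e]) f p₂ := by
  classical
  have hhead (q : G.Route) : ∀ g ∈ q.edges, ∀ g' ∈ q.edges, G.head g = G.head g' → g = g' :=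
    fun _ hg _ hg' => hG.eq_of_head_eq q.isPath hg hg'
  have htail (q : G.Route) : ∀ g ∈ q.edges, ∀ g' ∈ q.edges, G.tail g = G.tail g' → g = g' :=
    fun _ hg _ hg' => hG.eq_of_tail_eq q.isPath hg hg'
  rw [offset_routeFlow hs hhead, offset_routeFlow hr htail, position, position,
    ← Finset.sum_union, ← Finset.sum_union, ← Finset.filter_or, ← Finset.filter_or,
    Finset.sum_filter, Finset.sum_filter]
  · refine Finset.sum_congr rfl fun q _ => ?_
    by_cases hq : c q = 0
    · simp [hq]
    · exact if_congr (before_iff_before_next hr hs hp (hcross p hp0 q hq) (hcross q hq p hp0))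
        rfl rfl
  · exact Finset.disjoint_filter.2 fun q _ h => not_before_of_exists_mem hr htail h _ _
  · exact Finset.disjoint_filter.2 fun q _ h => not_before_of_exists_mem hs hhead h _ _

theorem follows_of_position [Fintype E] (hG : G.IsDAG) (hr : IsFiberOrder G.tail r)
    (hs : IsFiberOrder G.head s) (hc : ∀ p, 0 ≤ c p)
    (hcross : IsNoncrossing r s (Function.support c)) {p : G.Route} (hp0 : c p ≠ 0)
    {p₁ p₂ : List E} {e : E} (hp : p.edges = p₁ ++ e :: p₂) {z : ℝ}
    (hz : position r s c p₁ e p₂ ≤ z) (hz' : z < position r s c p₁ e p₂ + c p) :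
    Follows (offset r (routeFlow c)) (offset s (routeFlow c)) (routeFlow c)
      (offset r (routeFlow c) e + z) (e :: p₂) := by
  induction p₂ generalizing p₁ e z with
  | nil =>
    have hnonneg := position_nonneg (r := r) (s := s) hc p₁ e []
    have hle := position_add_le hG hr.irrefl hs.irrefl hc hp
    exact ⟨⟨by linarith, by linarith⟩, trivial⟩
  | cons f p₂ ih =>
    have hnonneg := position_nonneg (r := r) (s := s) hc p₁ e (f :: p₂)
    have hle := position_add_le hG hr.irrefl hs.irrefl hc hp
    have hnext := offset_add_position hG hr hs hcross hp0 hp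
    refine ⟨⟨by linarith, by linarith⟩, ?_⟩
    convert ih (p₁ := p₁ ++ [e]) (e := f)
      (z := z + offset s (routeFlow c) e - offset r (routeFlow c) f)
      (by simp [hp]) (by linarith) (by linarith) using 1
    ring

theorem le_carriedFlow_routeFlow [Fintype E] (hG : G.IsDAG) (hr : IsFiberOrder G.tail r)
    (hs : IsFiberOrder G.head s) (hc : ∀ p, 0 ≤ c p)
    (hcross : IsNoncrossing r s (Function.support c)) {p : G.Route} (hp : p.edges ≠ []) :
    c p ≤ p.carriedFlow r s (routeFlow c) := by
  by_cases hcp : c p = 0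
  · rw [hcp]
    exact followWeight_nonneg _
  obtain ⟨e, l, hl⟩ := List.exists_cons_of_ne_nil hp
  set y₀ := offset r (routeFlow c) e + position r s c [] e l
  have hsub : Set.Ico y₀ (y₀ + c p) ⊆ {y | Follows (offset r (routeFlow c))
      (offset s (routeFlow c)) (routeFlow c) y p.edges} := by
    intro y hy
    have hfol := follows_of_position hG hr hs hc hcross hcp (p₁ := []) hl
      (z := y - offset r (routeFlow c) e) (by linarith [hy.1]) (by linarith [hy.2])
    rwa [add_sub_cancel, ← hl] at hfol
  have hmono := MeasureTheory.measureReal_mono hsub (volume_follows_ne_top hp)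
  rwa [Real.volume_real_Ico, add_sub_cancel_left, max_eq_left (hc p)] at hmono

open Classical in
theorem sum_routeFlow [Fintype E] (hG : G.IsDAG) (c : G.Route → ℝ) (t : E → V) (v : V) :
    ∑ e with t e = v, routeFlow c e =
      ∑ p : G.Route, c p * (p.edges.map fun e => if t e = v then (1 : ℝ) else 0).sum := by
  simp only [routeFlow, Finset.sum_filter]
  have hswap (e : E) : (if t e = v then ∑ p : G.Route, (if e ∈ p.edges then c p else 0) else 0) =
      ∑ p : G.Route, c p * if e ∈ p.edges then (if t e = v then 1 else 0) else 0 := by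
    split_ifs <;> simp
  simp only [hswap]
  rw [Finset.sum_comm]
  refine Finset.sum_congr rfl fun p _ => ?_
  rw [← Finset.mul_sum, ← List.sum_toFinset _ (hG.nodup p.isPath), ← Finset.sum_filter]
  congr 2
  ext
  simp

open Classical in
theorem sum_head_routeFlow_eq_sum_tail [Fintype E] (hG : G.IsDAG) {v : V}
    (hv : ∀ p, c p ≠ 0 → p.start ≠ v ∧ p.finish ≠ v) :
    ∑ e with G.head e = v, routeFlow c e = ∑ e with G.tail e = v, routeFlow c e := by
  rw [sum_routeFlow hG, sum_routeFlow hG]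
  refine Finset.sum_congr rfl fun p _ => ?_
  by_cases hp : c p = 0
  · simp [hp]
  · have hbalance := p.isPath.sum_tail_sub_sum_head v
    rw [if_neg (hv p hp).1, if_neg (hv p hp).2, sub_self, sub_eq_zero] at hbalance
    rw [hbalance]

theorem isConserved_routeFlow [Fintype E] (hG : G.IsDAG) (c : G.Route → ℝ) :
    G.IsConserved (routeFlow c) := fun _ hsource hsink =>
  sum_head_routeFlow_eq_sum_tail hG fun p _ =>
    ⟨fun h => hsource (h ▸ p.isSource_start), fun h => hsink (h ▸ p.isSink_finish)⟩

theorem carriedFlow_routeFlow [Finite V] [Fintype E] (hG : G.IsDAG) (hr : IsFiberOrder G.tail r)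
    (hs : IsFiberOrder G.head s) (hc : ∀ p, 0 ≤ c p)
    (hcross : IsNoncrossing r s (Function.support c)) {p : G.Route} (hp : p.edges ≠ []) :
    p.carriedFlow r s (routeFlow c) = c p := by
  classical
  obtain ⟨e, l, hl⟩ := List.exists_cons_of_ne_nil hp
  have hnonneg (e : E) : 0 ≤ routeFlow c e := Finset.sum_nonneg fun _ _ => hc _
  have hle : ∀ q ∈ Finset.univ.filter fun q : G.Route => e ∈ q.edges,
      c q ≤ q.carriedFlow r s (routeFlow c) := fun q hq =>
    le_carriedFlow_routeFlow hG hr hs hc hcross (List.ne_nil_of_mem (Finset.mem_filter.1 hq).2)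
  have hsum := routeFlow_carriedFlow hG hr hs hnonneg (isConserved_routeFlow hG c) e
  exact ((Finset.sum_eq_sum_iff_of_le hle).1 hsum.symm p (by simp [hl])).symm

end MultiDigraph

/-! ### The augmented graph and its layerings -/

theorem isFiberOrder_of_linearOrder {V W E : Type*} {t : E → V ⊕ W}
    (o : ∀ i : V, LinearOrder {e // t e = .inl i})
    (hinj : ∀ w e f, t e = .inr w → t f = .inr w → e = f) :
    IsFiberOrder t fun f g => ∃ i, ∃ hf : t f = .inl i, ∃ hg : t g = .inl i,
      (o i).lt ⟨f, hf⟩ ⟨g, hg⟩ where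
  eq_of_lt := by
    rintro e f ⟨i, he, hf, -⟩
    rw [he, hf]
  irrefl := by
    rintro e ⟨i, he, _, h⟩
    let _ := o i
    exact lt_irrefl _ h
  trans := by
    rintro e f g ⟨i, he, hf, h⟩ ⟨j, hf', hg, h'⟩
    obtain rfl := Sum.inl_injective (hf.symm.trans hf')
    let _ := o i
    exact ⟨i, he, hg, lt_trans h h'⟩
  total := by
    intro e f hef
    obtain ⟨i, he⟩ | ⟨w, he⟩ : (∃ i, t e = .inl i) ∨ ∃ w, t e = .inr w := by cases t e <;> simp
    · have hf := hef.symm.trans he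
      let _ := o i
      rcases lt_trichotomy (⟨e, he⟩ : {e // t e = .inl i}) ⟨f, hf⟩ with h | h | h
      · exact Or.inr (Or.inl ⟨i, he, hf, h⟩)
      · exact Or.inl (congrArg Subtype.val h)
      · exact Or.inr (Or.inr ⟨i, hf, he, h⟩)
    · exact Or.inl (hinj w e f he (hef.symm.trans he))

theorem MultiDigraph.lexLT_total {V E : Type*} {G : MultiDigraph V E} {r : E → E → Prop}
    (hr : IsFiberOrder G.tail r) {u v w : V} {p q : List E} (hp : G.IsPath u p v)
    (hq : G.IsPath u q w) (hv : G.IsSink v) (hw : G.IsSink w) :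
    p = q ∨ LexLT r p q ∨ LexLT r q p := by
  induction p generalizing u q with
  | nil =>
    cases q with
    | nil => exact Or.inl rfl
    | cons f q => exact (hv f (hq.1.trans hp)).elim
  | cons e p ih =>
    cases q with
    | nil => exact (hw e (hp.1.trans hq)).elim
    | cons f q =>
      rcases hr.total e f (hp.1.trans hq.1.symm) with rfl | h | h
      · rcases ih hp.2 hq.2 with rfl | h | h
        · exact Or.inl rfl
        · exact Or.inr (Or.inl (h.append_left [e]))
        · exact Or.inr (Or.inr (h.append_left [e]))
      · exact Or.inr (Or.inl (LexLT.cons_iff.2 (Or.inl h)))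
      · exact Or.inr (Or.inr (LexLT.cons_iff.2 (Or.inl h)))

namespace Augmentation

open MultiDigraph

variable {V E VX VY EX EY : Type*} [Fintype EX] [Fintype EY]
  {G : MultiDigraph V E} {a : V → ℤ} {A : Augmentation G a VX VY EX EY}

theorem isSource_inflow (s : VX) : A.graph.IsSource (.inr (.inl s)) := by
  rintro (e | x | y) <;> simp [graph]

theorem isSink_outflow (y : VY) : A.graph.IsSink (.inr (.inr y)) := by
  rintro (e | x | y) <;> simp [graph]

theorem not_isSink_inflow (s : VX) : ¬ A.graph.IsSink (.inr (.inl s)) := by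
  intro h
  obtain ⟨x, hx, -⟩ := A.existsUnique_x s
  exact h (.inr (.inl x)) (by simp [graph, hx])

theorem not_isSource_outflow (y : VY) : ¬ A.graph.IsSource (.inr (.inr y)) := by
  intro h
  obtain ⟨x, hx, -⟩ := A.existsUnique_y y
  exact h (.inr (.inr x)) (by simp [graph, hx])

theorem exists_isPath_of_graph {u w : V} {l : List (E ⊕ EX ⊕ EY)}
    (h : A.graph.IsPath (.inl u) l (.inl w)) : ∃ m, l = m.map Sum.inl ∧ G.IsPath u m w := by
  induction l generalizing u with
  | nil => exact ⟨[], rfl, Sum.inl_injective h⟩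
  | cons e l ih =>
    rcases e with e | x | y
    · obtain ⟨m, rfl, hm⟩ := ih h.2
      exact ⟨e :: m, rfl, Sum.inl_injective h.1, hm⟩
    · simp [IsPath, graph] at h
    · cases l with
      | nil => simp [IsPath, graph] at h
      | cons f l => exact (isSink_outflow _ f h.2.1).elim

theorem exists_of_tail_eq_inflow {e : E ⊕ EX ⊕ EY} {s : VX}
    (h : A.graph.tail e = .inr (.inl s)) : ∃ x, e = .inr (.inl x) ∧ A.xTail x = s := by
  rcases e with e | x | y
  · simp [graph] at h
  · exact ⟨x, rfl, by simpa [graph] using h⟩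
  · simp [graph] at h

theorem exists_of_head_eq_outflow {e : E ⊕ EX ⊕ EY} {v : VY}
    (h : A.graph.head e = .inr (.inr v)) : ∃ y, e = .inr (.inr y) ∧ A.yHead y = v := by
  rcases e with e | x | y
  · simp [graph] at h
  · simp [graph] at h
  · exact ⟨y, rfl, by simpa [graph] using h⟩

theorem isDAG_graph (hG : G.IsDAG) : A.graph.IsDAG := by
  intro v l h
  rcases v with v | s | y
  · obtain ⟨m, rfl, hm⟩ := exists_isPath_of_graph h
    simp [hG v m hm]
  · have hrev := h.reverse
    cases hl : l.reverse with
    | nil => simpa using hl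
    | cons e l' =>
      rw [hl] at hrev
      exact (isSource_inflow s e hrev.1).elim
  · cases l with
    | nil => rfl
    | cons e l => exact (isSink_outflow y e h.1).elim

namespace Framing

variable (F : A.Framing)

theorem isFiberOrder_outLT : IsFiberOrder A.graph.tail F.OutLT := by
  refine isFiberOrder_of_linearOrder F.out ?_
  rintro (s | y) e f he hf
  · obtain ⟨x, rfl, hx⟩ := exists_of_tail_eq_inflow he
    obtain ⟨x', rfl, hx'⟩ := exists_of_tail_eq_inflow hf
    rw [(A.existsUnique_x s).unique hx hx']
  · exact (isSink_outflow y e he).elim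

theorem isFiberOrder_incLT : IsFiberOrder A.graph.head F.IncLT := by
  refine isFiberOrder_of_linearOrder F.inc ?_
  rintro (s | y) e f he hf
  · exact (isSource_inflow s e he).elim
  · obtain ⟨x, rfl, hx⟩ := exists_of_head_eq_outflow he
    obtain ⟨x', rfl, hx'⟩ := exists_of_head_eq_outflow hf
    rw [(A.existsUnique_y y).unique hx hx']

variable {F}

theorem preLT_iff {p q : List (E ⊕ EX ⊕ EY)} :
    F.PreLT p q ↔ LexLT F.IncLT p.reverse q.reverse := by
  constructor
  · rintro ⟨σ, f, g, p', q', rfl, rfl, h⟩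
    exact ⟨σ.reverse, f, g, p'.reverse, q'.reverse, by simp, by simp, h⟩
  · rintro ⟨σ, f, g, p', q', hp, hq, h⟩
    rw [List.reverse_eq_iff] at hp hq
    exact ⟨σ.reverse, f, g, p'.reverse, q'.reverse, by simp [hp], by simp [hq], h⟩

theorem cross_iff {p q : A.graph.Route} :
    F.Cross p q ↔ Crosses F.OutLT F.IncLT p.edges q.edges := by
  constructor
  · rintro ⟨i, p₁, p₂, q₁, q₂, hp, hq, h₁, h₂⟩
    rw [hp.1, hq.1]
    exact crosses_of_lexLT (preLT_iff.1 h₁) h₂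
  · rintro ⟨σ, f, g, f', g', p', p'', q', q'', hp, hq, hfg, hgf⟩
    obtain ⟨hp₁, hp₂⟩ := isPath_append_cons.1 (hp ▸ p.isPath)
    obtain ⟨hq₁, hq₂⟩ := isPath_append_cons.1 (hq ▸ q.isPath)
    have hhead := F.isFiberOrder_incLT.eq_of_lt _ _ hfg
    rw [← hhead] at hq₂
    exact ⟨A.graph.head f, p' ++ [f], σ ++ f' :: p'', q' ++ [g], σ ++ g' :: q'',
      ⟨by simp [hp], isPath_append_cons.2 ⟨hp₁, rfl⟩, hp₂⟩,
      ⟨by simp [hq], isPath_append_cons.2 ⟨hq₁, hhead.symm⟩, hq₂⟩,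
      ⟨[], f, g, p', q', rfl, rfl, hfg⟩, ⟨σ, g', f', q'', p'', rfl, rfl, hgf⟩⟩

theorem isRouteClique_iff {R : Set A.graph.Route} :
    F.IsRouteClique R ↔ IsNoncrossing F.OutLT F.IncLT R :=
  ⟨fun h p hp q hq hpq => (h p hp q hq).1 (cross_iff.2 hpq),
    fun h p hp q hq => ⟨fun hpq => h p hp q hq (cross_iff.1 hpq),
      fun hqp => h q hq p hp (cross_iff.1 hqp)⟩⟩

theorem postLT_irrefl (p : List (E ⊕ EX ⊕ EY)) : ¬ F.PostLT p p :=
  LexLT.irrefl F.isFiberOrder_outLT.irrefl p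

theorem postLT_trans {p q s : List (E ⊕ EX ⊕ EY)} (h : F.PostLT p q) (h' : F.PostLT q s) :
    F.PostLT p s :=
  LexLT.trans F.isFiberOrder_outLT.trans h h'

end Framing

/-- A route from an inflow vertex to an outflow vertex. -/
def IsThrough (p : A.graph.Route) : Prop :=
  (∃ s, p.start = .inr (.inl s)) ∧ ∃ y, p.finish = .inr (.inr y)

theorem IsThrough.edges_ne_nil {p : A.graph.Route} (hp : IsThrough p) : p.edges ≠ [] := by
  intro h
  obtain ⟨⟨s, hs⟩, y, hy⟩ := hp
  have hpath := p.isPath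
  rw [h, hs, hy] at hpath
  simp [IsPath] at hpath

namespace IsLayering

variable {L M : Finset A.graph.Route}

theorem isThrough (hL : A.IsLayering L) {p : A.graph.Route} (hp : p ∈ L) : IsThrough p := by
  classical
  constructor
  · have h := hL.1 p.start p.isSource_start
    have hpos : 0 < (L.filter fun q => q.start = p.start).card :=
      Finset.card_pos.2 ⟨p, by simp [hp]⟩
    rcases hs : p.start with v | s | y
    · rw [hs] at h hpos
      simp only [netflow] at h
      omega
    · exact ⟨s, rfl⟩
    · exact (not_isSource_outflow y (hs ▸ p.isSource_start)).elim
  · have h := hL.2 p.finish p.isSink_finish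
    have hpos : 0 < (L.filter fun q => q.finish = p.finish).card :=
      Finset.card_pos.2 ⟨p, by simp [hp]⟩
    rcases hs : p.finish with v | s | y
    · rw [hs] at h hpos
      simp only [netflow, abs_zero] at h
      omega
    · exact (not_isSink_inflow s (hs ▸ p.isSink_finish)).elim
    · exact ⟨y, rfl⟩

theorem exists_start (hL : A.IsLayering L) (s : VX) : ∃ p ∈ L, p.start = .inr (.inl s) := by
  classical
  have h := hL.1 _ (isSource_inflow s)
  have hpos : 0 < (L.filter fun q => q.start = .inr (.inl s)).card := by
    simp only [netflow] at h
    omega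
  obtain ⟨p, hp⟩ := Finset.card_pos.1 hpos
  exact ⟨p, Finset.mem_filter.1 hp⟩

theorem eq_of_start_eq (hL : A.IsLayering L) {p q : A.graph.Route} (hp : p ∈ L) (hq : q ∈ L)
    (h : p.start = q.start) : p = q := by
  classical
  obtain ⟨⟨s, hs⟩, -⟩ := hL.isThrough hp
  have hcard := hL.1 _ (isSource_inflow s)
  simp only [netflow] at hcard
  have hle : (L.filter fun q => q.start = .inr (.inl s)).card ≤ 1 := by omega
  refine Finset.card_le_one.1 hle p ?_ q ?_
  · simp [hp, hs]
  · simp [hq, ← h, hs]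

theorem exists_ne_of_ne (hL : A.IsLayering L) (hM : A.IsLayering M) (hne : L ≠ M) :
    ∃ s : VX, ∃ p ∈ L, ∃ q ∈ M, p.start = .inr (.inl s) ∧ q.start = .inr (.inl s) ∧ p ≠ q := by
  by_contra! hcon
  apply hne
  ext p
  constructor
  · intro hp
    obtain ⟨⟨s, hs⟩, -⟩ := hL.isThrough hp
    obtain ⟨q, hq, hqs⟩ := hM.exists_start s
    rw [hcon s p hp q hq hs hqs]
    exact hq
  · intro hp
    obtain ⟨⟨s, hs⟩, -⟩ := hM.isThrough hp
    obtain ⟨q, hq, hqs⟩ := hL.exists_start s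
    rw [← hcon s q hq p hp hqs hs]
    exact hq

end IsLayering

namespace Framing

variable {F : A.Framing} {L M N : Finset A.graph.Route}

theorem srcLT_irrefl (hL : A.IsLayering L) : ¬ F.SrcLT L L := by
  rintro ⟨s, ⟨p, hp, q, hq, hps, hqs, h⟩, -⟩
  obtain rfl := hL.eq_of_start_eq hp hq (hps.trans hqs.symm)
  exact postLT_irrefl _ h

theorem srcLT_trans (hL : A.IsLayering L) (hM : A.IsLayering M) (hN : A.IsLayering N)
    (h : F.SrcLT L M) (h' : F.SrcLT M N) : F.SrcLT L N := by
  obtain ⟨s, ⟨p, hp, q, hq, hps, hqs, hlt⟩, hs⟩ := h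
  obtain ⟨s', ⟨q', hq', r, hr, hqs', hrs, hlt'⟩, hs'⟩ := h'
  let _ := F.src
  rcases lt_trichotomy s s' with hss | rfl | hss
  · obtain ⟨p', hp', hps'⟩ := hL.exists_start s'
    have hpq := hs s' hss p' hp' q' hq' hps' hqs'
    refine ⟨s', ⟨p', hp', r, hr, hps', hrs, by rwa [hpq]⟩, fun u hu x hx y hy hxu hyu => ?_⟩
    obtain ⟨z, hz, hzu⟩ := hM.exists_start u
    exact (hs u (lt_trans hss hu) x hx z hz hxu hzu).trans (hs' u hu z hz y hy hzu hyu)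
  · obtain rfl := hM.eq_of_start_eq hq hq' (hqs.trans hqs'.symm)
    refine ⟨s, ⟨p, hp, r, hr, hps, hrs, postLT_trans hlt hlt'⟩, fun u hu x hx y hy hxu hyu => ?_⟩
    obtain ⟨z, hz, hzu⟩ := hM.exists_start u
    exact (hs u hu x hx z hz hxu hzu).trans (hs' u hu z hz y hy hzu hyu)
  · obtain ⟨r', hr', hrs'⟩ := hN.exists_start s
    have hqr := hs' s hss q hq r' hr' hqs hrs'
    refine ⟨s, ⟨p, hp, r', hr', hps, hrs', by rwa [← hqr]⟩, fun u hu x hx y hy hxu hyu => ?_⟩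
    obtain ⟨z, hz, hzu⟩ := hM.exists_start u
    exact (hs u hu x hx z hz hxu hzu).trans (hs' u (lt_trans hss hu) z hz y hy hzu hyu)

theorem srcLT_total [Finite VX] (hL : A.IsLayering L) (hM : A.IsLayering M) :
    L = M ∨ F.SrcLT L M ∨ F.SrcLT M L := by
  by_cases hne : L = M
  · exact Or.inl hne
  right
  let _ := F.src
  obtain ⟨s, hs, hmax⟩ := (Set.toFinite {s : VX | ∃ p ∈ L, ∃ q ∈ M, p.start = .inr (.inl s) ∧
    q.start = .inr (.inl s) ∧ p ≠ q}).exists_maximal (hL.exists_ne_of_ne hM hne)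
  obtain ⟨p, hp, q, hq, hps, hqs, hpq⟩ := hs
  have hup : ∀ s' : VX, F.src.lt s s' → ∀ p ∈ L, ∀ q ∈ M,
      p.start = .inr (.inl s') → q.start = .inr (.inl s') → p = q := by
    intro s' hs' p hp q hq hps hqs
    by_contra h
    exact absurd (hmax ⟨p, hp, q, hq, hps, hqs, h⟩ (le_of_lt hs')) (not_le_of_gt hs')
  have hst := hps.trans hqs.symm
  rcases lexLT_total F.isFiberOrder_outLT p.isPath (hst ▸ q.isPath) p.isSink_finish
    q.isSink_finish with h | h | h
  · exact (hpq (Route.ext_of_start hst h)).elim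
  · exact Or.inl ⟨s, ⟨p, hp, q, hq, hps, hqs, h⟩, hup⟩
  · exact Or.inr ⟨s, ⟨q, hq, p, hp, hqs, hps, h⟩, fun s' hs' q hq p hp hqs hps =>
      (hup s' hs' p hp q hq hps hqs).symm⟩

theorem srcLT_asymm (hL : A.IsLayering L) (hM : A.IsLayering M) (h : F.SrcLT L M) :
    ¬ F.SrcLT M L := fun hML => srcLT_irrefl hL (srcLT_trans hL hM hL h hML)

theorem exists_least_layering [Finite VX] [Finite A.graph.Route] (P : Set (Finset A.graph.Route))
    (hP : ∀ L ∈ P, A.IsLayering L) (hne : P.Nonempty) :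
    ∃ L ∈ P, ∀ M ∈ P, M = L ∨ F.SrcLT L M := by
  classical
  have := Fintype.ofFinite A.graph.Route
  let r : P → P → Prop := fun L M => F.SrcLT L M
  have : IsTrans P r := ⟨fun L M N h h' =>
    srcLT_trans (hP _ L.2) (hP _ M.2) (hP _ N.2) h h'⟩
  have : Std.Irrefl r := ⟨fun L => srcLT_irrefl (hP _ L.2)⟩
  obtain ⟨L, -, hL⟩ := (Finite.wellFounded_of_trans_of_irrefl r).has_min Set.univ
    ⟨⟨_, hne.some_mem⟩, trivial⟩
  refine ⟨L, L.2, fun M hM => ?_⟩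
  rcases srcLT_total (F := F) (hP _ hM) (hP _ L.2) with h | h | h
  · exact Or.inl h
  · exact (hL ⟨M, hM⟩ trivial h).elim
  · exact Or.inr h

end Framing

end Augmentation

/-! ### Decomposition of route weights into layerings -/

theorem sum_sum_filter_and_eq {ι β γ : Type*} [Fintype ι] [Fintype γ] [DecidableEq β]
    {P : ι → Prop} [DecidablePred P] {f : ι → β} {g : γ → β} (hg : Function.Injective g) {c : ι → ℝ}
    (h : ∀ i, P i → c i ≠ 0 → f i ∈ Set.range g) :
    ∑ k, ∑ i with P i ∧ f i = g k, c i = ∑ i with P i, c i := by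
  classical
  simp only [Finset.sum_filter]
  rw [Finset.sum_comm]
  refine Finset.sum_congr rfl fun i _ => ?_
  by_cases hi : P i ∧ c i ≠ 0
  · obtain ⟨k, hk⟩ := h i hi.1 hi.2
    simp [hi.1, ← hk, hg.eq_iff]
  · rw [not_and_not_right] at hi
    by_cases hP : P i <;> simp_all

section Hall

open Finset

variable {X Y : Type*} [Fintype X] [Fintype Y] [DecidableEq Y] {n : Y → ℕ}

theorem exists_forall_mem_card_fiber_eq {T : X → Finset Y}
    (hall : ∀ X' : Finset X, #X' ≤ ∑ y ∈ X'.biUnion T, n y) (hcard : Fintype.card X = ∑ y, n y) :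
    ∃ g : X → Y, (∀ x, g x ∈ T x) ∧ ∀ y, #{x | g x = y} = n y := by
  classical
  -- Hall's theorem, with `n y` copies of each `y`
  let slots (x : X) : Finset (Σ y, Fin (n y)) := (T x).sigma fun _ => univ
  have hslots (X' : Finset X) : #X' ≤ #(X'.biUnion slots) := by
    have hsigma : X'.biUnion slots = (X'.biUnion T).sigma fun _ => univ := by
      ext
      simp [slots]
    simpa [hsigma] using hall X'
  obtain ⟨f, hf, hfT⟩ := (all_card_le_biUnion_card_iff_exists_injective slots).1 hslots
  have hle (y : Y) : #{x | (f x).1 = y} ≤ n y := by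
    have hfiber : #(({y} : Finset Y).sigma fun y => (univ : Finset (Fin (n y)))) = n y := by simp
    rw [← hfiber]
    exact card_le_card_of_injOn f (fun x hx => by simpa using hx) hf.injOn
  have hsum : ∑ y, #{x | (f x).1 = y} = ∑ y, n y := by
    rw [← hcard, ← card_univ, card_eq_sum_card_fiberwise fun x _ => mem_univ (f x).1]
  exact ⟨fun x => (f x).1, fun x => (mem_sigma.1 (hfT x)).1,
    fun y => (sum_eq_sum_iff_of_le fun y _ => hle y).1 hsum y (mem_univ y)⟩

theorem exists_forall_ne_zero_card_fiber_eq {M : X → Y → ℝ} {t : ℝ} (ht : 0 < t)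
    (hM : ∀ x y, 0 ≤ M x y) (hrow : ∀ x, ∑ y, M x y = t) (hcol : ∀ y, ∑ x, M x y = t * n y) :
    ∃ g : X → Y, (∀ x, M x (g x) ≠ 0) ∧ ∀ y, #{x | g x = y} = n y := by
  classical
  let T (x : X) : Finset Y := {y | M x y ≠ 0}
  suffices h : ∃ g : X → Y, (∀ x, g x ∈ T x) ∧ ∀ y, #{x | g x = y} = n y by simpa [T] using h
  refine exists_forall_mem_card_fiber_eq (fun X' => ?_) ?_
  · have hle : t * #X' ≤ t * ∑ y ∈ X'.biUnion T, (n y : ℝ) := calc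
      t * #X' = ∑ x ∈ X', ∑ y, M x y := by simp [hrow, mul_comm]
      _ = ∑ x ∈ X', ∑ y ∈ X'.biUnion T, M x y := by
        refine sum_congr rfl fun x hx => (sum_subset (subset_univ _) fun y _ hy => ?_).symm
        by_contra hxy
        exact hy (mem_biUnion.2 ⟨x, hx, by simpa [T] using hxy⟩)
      _ ≤ ∑ x, ∑ y ∈ X'.biUnion T, M x y :=
        sum_le_univ_sum_of_nonneg fun x => sum_nonneg fun y _ => hM x y
      _ = t * ∑ y ∈ X'.biUnion T, (n y : ℝ) := by
        rw [sum_comm, mul_sum]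
        exact sum_congr rfl fun y _ => hcol y
    exact_mod_cast le_of_mul_le_mul_left hle ht
  · have heq : t * Fintype.card X = t * ∑ y, (n y : ℝ) := calc
      t * Fintype.card X = ∑ x, ∑ y, M x y := by simp [hrow, mul_comm]
      _ = t * ∑ y, (n y : ℝ) := by
        rw [sum_comm, mul_sum]
        exact sum_congr rfl fun y _ => hcol y
    exact_mod_cast mul_left_cancel₀ ht.ne' heq

end Hall

open Classical in
/-- The total weight of the members of `S` that contain `p`: the route weights induced by weights
on a set `S` of layerings. -/
noncomputable def layerSum {ι : Type*} (S : Finset (Finset ι)) (w : Finset ι → ℝ) (p : ι) : ℝ :=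
  ∑ L ∈ S with p ∈ L, w L

section LayerSum

variable {ι : Type*} {S : Finset (Finset ι)} {w : Finset ι → ℝ} {L : Finset ι} {p : ι}

theorem layerSum_ne_zero_iff (hw : ∀ L ∈ S, 0 < w L) : layerSum S w p ≠ 0 ↔ ∃ L ∈ S, p ∈ L := by
  classical
  rw [layerSum, Ne, Finset.sum_eq_zero_iff_of_nonneg fun L hL => (hw L (by simp_all)).le]
  simp only [Finset.mem_filter, and_imp, not_forall]
  exact ⟨fun ⟨L, hL, hp, _⟩ => ⟨L, hL, hp⟩, fun ⟨L, hL, hp⟩ => ⟨L, hL, hp, (hw L hL).ne'⟩⟩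

theorem le_layerSum (hw : ∀ L ∈ S, 0 < w L) (hL : L ∈ S) (hp : p ∈ L) : w L ≤ layerSum S w p := by
  classical
  exact Finset.single_le_sum (fun M hM => (hw M (by simp_all)).le) (by simp [hL, hp])

theorem layerSum_eq_of_forall_ne (hL : L ∈ S) (hp : p ∈ L) (hne : ∀ M ∈ S, M ≠ L → p ∉ M) :
    layerSum S w p = w L := by
  classical
  refine Finset.sum_eq_single L (fun M hM hML => ?_) fun h => (h (by simp [hL, hp])).elim
  rw [Finset.mem_filter] at hM
  exact (hne M hM.1 hML hM.2).elim

theorem layerSum_insert [DecidableEq ι] (hL : L ∉ S) :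
    layerSum (insert L S) w p = (if p ∈ L then w L else 0) + layerSum S w p := by
  classical
  simp only [layerSum, Finset.sum_filter]
  convert Finset.sum_insert hL

theorem layerSum_congr {v : Finset ι → ℝ} (h : ∀ L ∈ S, v L = w L) :
    layerSum S v p = layerSum S w p :=
  Finset.sum_congr rfl fun L hL => h L (by simp_all)

end LayerSum

namespace Augmentation

open MultiDigraph

variable {V E VX VY EX EY : Type*} [Fintype EX] [Fintype EY]
  {G : MultiDigraph V E} {a : V → ℤ} {A : Augmentation G a VX VY EX EY}

section IsBalanced

open Classical in
/-- Nonnegative weights on the routes with the same total at each inflow and each outflow vertex as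
a family of layerings of total weight `t`. -/
structure IsBalanced [Fintype A.graph.Route] (c : A.graph.Route → ℝ) (t : ℝ) : Prop where
  nonneg : ∀ p, 0 ≤ c p
  isThrough : ∀ p, c p ≠ 0 → IsThrough p
  sum_start : ∀ s : VX, ∑ p with p.start = .inr (.inl s), c p = t
  sum_finish : ∀ y : VY, ∑ p with p.finish = .inr (.inr y), c p = t * |A.aY y|

variable [Fintype A.graph.Route] {c d : A.graph.Route → ℝ} {t u : ℝ} {L : Finset A.graph.Route}

theorem IsBalanced.sub (hc : IsBalanced c t) (hd : IsBalanced d u) (hle : ∀ p, d p ≤ c p) :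
    IsBalanced (fun p => c p - d p) (t - u) where
  nonneg p := sub_nonneg.2 (hle p)
  isThrough p hp := hc.isThrough p fun hcp => hp <| by
    have := hle p
    have := hd.nonneg p
    linarith
  sum_start s := by rw [Finset.sum_sub_distrib, hc.sum_start, hd.sum_start]
  sum_finish y := by rw [Finset.sum_sub_distrib, hc.sum_finish, hd.sum_finish, sub_mul]

theorem IsBalanced.total_nonneg [Nonempty VX] (hc : IsBalanced c t) : 0 ≤ t := by
  rw [← hc.sum_start (Classical.arbitrary VX)]
  exact Finset.sum_nonneg fun p _ => hc.nonneg p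

theorem IsBalanced.eq_zero (hc : IsBalanced c 0) (p : A.graph.Route) : c p = 0 := by
  by_contra hp
  obtain ⟨⟨s, hs⟩, -⟩ := hc.isThrough p hp
  have hzero := (Finset.sum_eq_zero_iff_of_nonneg fun q _ => hc.nonneg q).1 (hc.sum_start s)
  exact hp (hzero p (by simp [hs]))

open Classical in
theorem IsLayering.isBalanced (hL : A.IsLayering L) (ht : 0 ≤ t) :
    IsBalanced (fun p => if p ∈ L then t else 0) t where
  nonneg p := by split_ifs <;> simp [ht]
  isThrough p hp := hL.isThrough (by simp_all)
  sum_start s := by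
    have hcard : ((L.filter fun p => p.start = .inr (.inl s)).card : ℝ) = 1 := by
      simpa [netflow] using congrArg (Int.cast (R := ℝ)) (hL.1 _ (isSource_inflow s))
    have hfilter : ({p | p.start = .inr (.inl s)} : Finset A.graph.Route).filter (· ∈ L) =
        L.filter fun p => p.start = .inr (.inl s) := by
      ext
      simp [and_comm]
    rw [← Finset.sum_filter, hfilter, Finset.sum_const, nsmul_eq_mul, hcard, one_mul]
  sum_finish y := by
    have hcard : ((L.filter fun p => p.finish = .inr (.inr y)).card : ℝ) = |A.aY y| := by
      exact_mod_cast hL.2 _ (isSink_outflow y)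
    have hfilter : ({p | p.finish = .inr (.inr y)} : Finset A.graph.Route).filter (· ∈ L) =
        L.filter fun p => p.finish = .inr (.inr y) := by
      ext
      simp [and_comm]
    rw [← Finset.sum_filter, hfilter, Finset.sum_const, nsmul_eq_mul, hcard, mul_comm]

theorem isBalanced_layerSum {S : Finset (Finset A.graph.Route)} (hS : ∀ L ∈ S, A.IsLayering L)
    {w : Finset A.graph.Route → ℝ} (hw : ∀ L ∈ S, 0 ≤ w L) :
    IsBalanced (layerSum S w) (∑ L ∈ S, w L) where
  nonneg p := Finset.sum_nonneg fun L hL => hw L (by simp_all)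
  isThrough p hp := by
    obtain ⟨L, hL, -⟩ := Finset.exists_ne_zero_of_sum_ne_zero hp
    simp only [Finset.mem_filter] at hL
    exact (hS L hL.1).isThrough hL.2
  sum_start s := by
    simp only [layerSum, Finset.sum_filter _ (w ·)]
    rw [Finset.sum_comm]
    exact Finset.sum_congr rfl fun L hL => ((hS L hL).isBalanced (hw L hL)).sum_start s
  sum_finish y := by
    simp only [layerSum, Finset.sum_filter _ (w ·)]
    rw [Finset.sum_comm, Finset.sum_mul]
    exact Finset.sum_congr rfl fun L hL => ((hS L hL).isBalanced (hw L hL)).sum_finish y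

end IsBalanced

section ExistsLayering

open Classical in
theorem isLayering_image [Fintype VX] {p : VX → A.graph.Route} {g : VX → VY}
    (hstart : ∀ s, (p s).start = .inr (.inl s)) (hfinish : ∀ s, (p s).finish = .inr (.inr (g s)))
    (hg : ∀ y, (Finset.univ.filter fun s => g s = y).card = (A.aY y).natAbs) :
    A.IsLayering (Finset.univ.image p) := by
  have hinj : Function.Injective p := fun s s' h => by
    simpa using (hstart s).symm.trans ((congrArg Route.start h).trans (hstart s'))
  constructor
  · intro i hi
    rw [Finset.filter_image, Finset.card_image_of_injective _ hinj]
    simp only [hstart]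
    rcases i with v | s | y
    · simp [netflow]
    · have hsingle : (Finset.univ.filter fun s' : VX => s' = s) = {s} := by
        ext
        simp
      simp [netflow, hsingle]
    · exact (not_isSource_outflow y hi).elim
  · intro j hj
    rw [Finset.filter_image, Finset.card_image_of_injective _ hinj]
    simp only [hfinish]
    rcases j with v | s | y
    · simp [netflow]
    · exact (not_isSink_inflow s hj).elim
    · simp [netflow, hg]

theorem IsBalanced.exists_layering [Finite VX] [Finite VY] [Fintype A.graph.Route]
    {c : A.graph.Route → ℝ} {t : ℝ} (hc : IsBalanced c t) (ht : 0 < t) :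
    ∃ L, A.IsLayering L ∧ ∀ p ∈ L, c p ≠ 0 := by
  classical
  have := Fintype.ofFinite VX
  have := Fintype.ofFinite VY
  let M (s : VX) (y : VY) : ℝ :=
    ∑ p with p.start = .inr (.inl s) ∧ p.finish = .inr (.inr y), c p
  have hrow (s : VX) : ∑ y, M s y = t := by
    rw [← hc.sum_start s]
    refine sum_sum_filter_and_eq (Sum.inr_injective.comp Sum.inr_injective) fun p _ hp => ?_
    exact (hc.isThrough p hp).2.imp fun y hy => hy.symm
  have hcol (y : VY) : ∑ s, M s y = t * (A.aY y).natAbs := by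
    rw [Nat.cast_natAbs, ← hc.sum_finish y]
    simp only [M, and_comm (b := _ = Sum.inr (Sum.inr y))]
    refine sum_sum_filter_and_eq (Sum.inr_injective.comp Sum.inl_injective) fun p _ hp => ?_
    exact (hc.isThrough p hp).1.imp fun s hs => hs.symm
  obtain ⟨g, hgM, hg⟩ := exists_forall_ne_zero_card_fiber_eq ht
    (fun s y => Finset.sum_nonneg fun p _ => hc.nonneg p) hrow hcol
  have hex (s : VX) : ∃ p : A.graph.Route, c p ≠ 0 ∧ p.start = .inr (.inl s) ∧
      p.finish = .inr (.inr (g s)) := by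
    obtain ⟨p, hp, hcp⟩ := Finset.exists_ne_zero_of_sum_ne_zero (hgM s)
    exact ⟨p, hcp, by simpa using hp⟩
  choose p hcp hstart hfinish using hex
  exact ⟨Finset.univ.image p, isLayering_image hstart hfinish hg, by simpa using hcp⟩

end ExistsLayering

namespace Framing

variable {F : A.Framing} {S T : Finset (Finset A.graph.Route)} {L M : Finset A.graph.Route}
  {v w : Finset A.graph.Route → ℝ}

theorem IsLayeringSimplex.mono (hS : F.IsLayeringSimplex S) (hT : T ⊆ S) :
    F.IsLayeringSimplex T where
  isLayering L hL := hS.isLayering L (hT hL)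
  isRouteClique := by
    rintro p ⟨L, hL, hp⟩ q ⟨M, hM, hq⟩
    exact hS.isRouteClique p ⟨L, hT hL, hp⟩ q ⟨M, hT hM, hq⟩
  isMin L hL M hM h := hS.isMin L (hT hL) M hM fun p hp => by
    obtain ⟨N, ⟨hN, h'⟩, hpN⟩ := h p hp
    exact ⟨N, ⟨hT hN, h'⟩, hpN⟩
  exists_new L hL := by
    obtain ⟨p, hp, h⟩ := hS.exists_new L (hT hL)
    exact ⟨p, hp, fun ⟨N, ⟨hN, h'⟩, hpN⟩ => h ⟨N, ⟨hT hN, h'⟩, hpN⟩⟩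

theorem isLayeringSimplex_empty : F.IsLayeringSimplex ∅ where
  isLayering := by simp
  isRouteClique := by
    rintro p ⟨L, hL, -⟩
    simp at hL
  isMin := by simp
  exists_new := by simp

theorem IsLayeringSimplex.insert_least [DecidableEq (Finset A.graph.Route)]
    (hS : F.IsLayeringSimplex S) (hL : A.IsLayering L)
    (hclique : F.IsRouteClique (A.routes (insert L S : Finset _)))
    (hmin : ∀ M, A.IsLayering M → (∀ p ∈ M, p ∈ A.routes (insert L S : Finset _)) →
      M = L ∨ F.SrcLT L M)
    (hnew : ∃ p ∈ L, p ∉ A.routes S) : F.IsLayeringSimplex (insert L S) := by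
  obtain ⟨p₀, hp₀, hp₀S⟩ := hnew
  have hLS : L ∉ S := fun h => hp₀S ⟨L, h, hp₀⟩
  have hnlt : ∀ M ∈ S, ¬ F.SrcLT M L := fun M hM => by
    have hML : M ≠ L := fun h => hLS (h ▸ hM)
    refine srcLT_asymm hL (hS.isLayering M hM) ((hmin M (hS.isLayering M hM) ?_).resolve_left hML)
    exact fun p hp => ⟨M, Finset.mem_insert_of_mem hM, hp⟩
  refine ⟨?_, hclique, ?_, ?_⟩ <;> intro M hM <;> rcases Finset.mem_insert.1 hM with rfl | hM'
  · exact hL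
  · exact hS.isLayering M hM'
  · exact fun N hN hNr => hmin N hN fun p hp => (hNr p hp).imp fun K hK => ⟨hK.1.1, hK.2⟩
  · refine fun N hN hNr => hS.isMin M hM' N hN fun p hp => ?_
    obtain ⟨K, ⟨hK, hK'⟩, hpK⟩ := hNr p hp
    refine ⟨K, ⟨Finset.mem_of_mem_insert_of_ne hK ?_, hK'⟩, hpK⟩
    rintro rfl
    exact hK'.elim (fun h => hLS (h ▸ hM')) (hnlt M hM')
  · refine ⟨p₀, hp₀, fun ⟨K, ⟨hK, hK'⟩, hpK⟩ => ?_⟩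
    rcases Finset.mem_insert.1 hK with rfl | hK
    · exact srcLT_irrefl hL hK'
    · exact hp₀S ⟨K, hK, hpK⟩
  · obtain ⟨p, hp, hnew⟩ := hS.exists_new M hM'
    refine ⟨p, hp, fun ⟨K, ⟨hK, hK'⟩, hpK⟩ => hnew ⟨K, ⟨?_, hK'⟩, hpK⟩⟩
    refine Finset.mem_of_mem_insert_of_ne hK ?_
    rintro rfl
    exact hnlt M hM' hK'

theorem IsLayeringSimplex.exists_least [Finite VX] [Finite A.graph.Route]
    (hS : F.IsLayeringSimplex S) (hne : S.Nonempty) : ∃ L ∈ S, ∀ M ∈ S, M = L ∨ F.SrcLT L M :=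
  exists_least_layering (S : Set (Finset A.graph.Route)) hS.isLayering hne

theorem IsLayeringSimplex.eq_or_srcLT_of_least (hS : F.IsLayeringSimplex S) (hL : L ∈ S)
    (hleast : ∀ N ∈ S, N = L ∨ F.SrcLT L N) (hM : A.IsLayering M)
    (hMS : ∀ p ∈ M, p ∈ A.routes S) : M = L ∨ F.SrcLT L M :=
  hS.isMin L hL M hM fun p hp =>
    (hMS p hp).imp fun N hN => ⟨⟨hN.1, hleast N hN.1⟩, hN.2⟩

theorem IsLayeringSimplex.exists_layerSum_eq_of_least (hS : F.IsLayeringSimplex S) (hL : L ∈ S)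
    (hleast : ∀ N ∈ S, N = L ∨ F.SrcLT L N) : ∃ p ∈ L, layerSum S w p = w L := by
  obtain ⟨p, hp, hnew⟩ := hS.exists_new L hL
  refine ⟨p, hp, layerSum_eq_of_forall_ne hL hp fun M hM hML hpM => ?_⟩
  exact hnew ⟨M, ⟨hM, (hleast M hM).resolve_left hML⟩, hpM⟩

theorem IsLayeringSimplex.exists_common_least [Finite VX] [Finite A.graph.Route]
    (hS : F.IsLayeringSimplex S) (hT : F.IsLayeringSimplex T) (hne : S.Nonempty)
    (hv : ∀ L ∈ S, 0 < v L) (hw : ∀ L ∈ T, 0 < w L)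
    (h : ∀ p, layerSum S v p = layerSum T w p) : ∃ L ∈ S, L ∈ T ∧ v L = w L := by
  have hroutes : A.routes (S : Set (Finset A.graph.Route)) = A.routes T := by
    ext p
    exact (layerSum_ne_zero_iff hv).symm.trans (h p ▸ layerSum_ne_zero_iff hw)
  obtain ⟨L, hL, hLleast⟩ := hS.exists_least hne
  have hTne : T.Nonempty := by
    obtain ⟨p, hp, -⟩ := hS.exists_new L hL
    obtain ⟨M, hM, -⟩ : p ∈ A.routes T := hroutes ▸ ⟨L, hL, hp⟩
    exact ⟨M, hM⟩
  obtain ⟨M, hM, hMleast⟩ := hT.exists_least hTne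
  have hML := hS.eq_or_srcLT_of_least hL hLleast (hT.isLayering M hM) fun p hp =>
    hroutes ▸ ⟨M, hM, hp⟩
  have hLM := hT.eq_or_srcLT_of_least hM hMleast (hS.isLayering L hL) fun p hp =>
    hroutes ▸ ⟨L, hL, hp⟩
  obtain rfl : M = L := hML.elim id fun hlt =>
    (hLM.resolve_right (srcLT_asymm (hS.isLayering L hL) (hT.isLayering M hM) hlt)).symm
  obtain ⟨p, hp, hpv⟩ := hS.exists_layerSum_eq_of_least (w := v) hL hLleast
  obtain ⟨q, hq, hqw⟩ := hT.exists_layerSum_eq_of_least (w := w) hM hMleast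
  refine ⟨M, hL, hM, le_antisymm ?_ ?_⟩
  · rw [← hqw, ← h]
    exact le_layerSum hv hL hq
  · rw [← hpv, h]
    exact le_layerSum hw hM hp

theorem IsLayeringSimplex.layerSum_inj [Finite VX] [Finite A.graph.Route]
    (hS : F.IsLayeringSimplex S) (hT : F.IsLayeringSimplex T) (hv : ∀ L ∈ S, 0 < v L)
    (hw : ∀ L ∈ T, 0 < w L) (h : ∀ p, layerSum S v p = layerSum T w p) :
    S = T ∧ ∀ L ∈ S, v L = w L := by
  classical
  induction S using Finset.strongInduction generalizing T with
  | H S ih =>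
    rcases S.eq_empty_or_nonempty with rfl | hne
    · refine ⟨(Finset.eq_empty_of_forall_notMem fun L hL => ?_).symm, by simp⟩
      obtain ⟨p, hp, -⟩ := hT.exists_new L hL
      refine (layerSum_ne_zero_iff hw).2 ⟨L, hL, hp⟩ ?_
      rw [← h, layerSum, Finset.filter_empty, Finset.sum_empty]
    obtain ⟨L, hLS, hLT, hvw⟩ := hS.exists_common_least hT hne hv hw h
    rw [← Finset.insert_erase hLS, ← Finset.insert_erase hLT]
    rw [← Finset.insert_erase hLS, ← Finset.insert_erase hLT] at h
    obtain ⟨hST, hvw'⟩ := ih (S.erase L) (Finset.erase_ssubset hLS)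
      (hS.mono (S.erase_subset L)) (hT.mono (T.erase_subset L))
      (fun N hN => hv N (Finset.mem_of_mem_erase hN))
      (fun N hN => hw N (Finset.mem_of_mem_erase hN)) fun p => by
        simpa [layerSum_insert, hvw] using h p
    exact ⟨by rw [hST], Finset.forall_mem_insert _ _ _ |>.2 ⟨hvw, hvw'⟩⟩

theorem IsLayeringSimplex.exists_layerSum_eq_of_add (hS : F.IsLayeringSimplex S)
    (hw : ∀ L ∈ S, 0 < w L) (hL : A.IsLayering L) {m : ℝ} (hm : 0 < m) {c d : A.graph.Route → ℝ}
    (hd : layerSum S w = d) (hcL : ∀ p ∈ L, c p = d p + m) (hcd : ∀ p ∉ L, c p = d p)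
    (hd_nonneg : ∀ p, 0 ≤ d p) (hclique : F.IsRouteClique (Function.support c))
    (hleast : ∀ M, A.IsLayering M → (∀ p ∈ M, c p ≠ 0) → M = L ∨ F.SrcLT L M)
    (hnew : ∃ p ∈ L, d p = 0) :
    ∃ T v, F.IsLayeringSimplex T ∧ (∀ L ∈ T, 0 < v L) ∧ layerSum T v = c := by
  classical
  have hroutes (p : A.graph.Route) : p ∈ A.routes S ↔ d p ≠ 0 := by
    rw [← hd]
    exact (layerSum_ne_zero_iff hw).symm
  have hnewS : ∃ p ∈ L, p ∉ A.routes S := by simpa [hroutes] using hnew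
  have hLS : L ∉ S := fun h => by
    obtain ⟨p, hp, hpS⟩ := hnewS
    exact hpS ⟨L, h, hp⟩
  have hsupport : A.routes (insert L S : Finset _) ⊆ Function.support c := by
    rintro p ⟨M, hM, hpM⟩
    by_cases hpL : p ∈ L
    · exact (hcL p hpL).trans_ne (add_pos_of_nonneg_of_pos (hd_nonneg p) hm).ne'
    · have hMS := Finset.mem_of_mem_insert_of_ne hM fun h => hpL (h ▸ hpM)
      exact (hcd p hpL).trans_ne ((hroutes p).1 ⟨M, hMS, hpM⟩)
  have hwL : ∀ M ∈ S, Function.update w L m M = w M := fun M hM =>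
    Function.update_of_ne (ne_of_mem_of_not_mem hM hLS) ..
  refine ⟨insert L S, Function.update w L m, hS.insert_least hL
    (fun p hp q hq => hclique p (hsupport hp) q (hsupport hq))
    (fun M hM hMr => hleast M hM fun p hp => hsupport (hMr p hp)) hnewS,
    (Finset.forall_mem_insert _ _ _).2 ⟨by simpa using hm, fun M hM => ?_⟩, funext fun p => ?_⟩
  · simpa only [hwL M hM] using hw M hM
  · rw [layerSum_insert hLS, layerSum_congr hwL, hd, Function.update_self]
    split_ifs with hp
    · rw [hcL p hp, add_comm]
    · rw [hcd p hp, zero_add]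

theorem exists_layerSum_eq [Finite VX] [Finite VY] [Nonempty VX] [Fintype A.graph.Route]
    {c : A.graph.Route → ℝ} {t : ℝ} (hc : IsBalanced c t)
    (hclique : F.IsRouteClique (Function.support c)) :
    ∃ S w, F.IsLayeringSimplex S ∧ (∀ L ∈ S, 0 < w L) ∧ layerSum S w = c := by
  classical
  induction hn : (Function.support c).ncard using Nat.strong_induction_on generalizing c t with
  | h n ih =>
  obtain rfl | ht := hc.total_nonneg.eq_or_lt
  · exact ⟨∅, 0, isLayeringSimplex_empty, by simp, funext fun p => by simp [layerSum, hc.eq_zero p]⟩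
  -- Subtract the least layering supported in `c`, with the largest weight it can have.
  obtain ⟨L, ⟨hL, hLc⟩, hleast⟩ := exists_least_layering (F := F)
    {L | A.IsLayering L ∧ ∀ p ∈ L, c p ≠ 0} (fun L h => h.1) (hc.exists_layering ht)
  obtain ⟨p, hp, -⟩ := hL.exists_start (Classical.arbitrary VX)
  obtain ⟨p₀, hp₀, hp₀min⟩ := L.exists_min_image c ⟨p, hp⟩
  have hpos : 0 < c p₀ := (hc.nonneg p₀).lt_of_ne' (hLc p₀ hp₀)
  let d (p : A.graph.Route) : ℝ := c p - if p ∈ L then c p₀ else 0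
  have hd : IsBalanced d (t - c p₀) := hc.sub (hL.isBalanced hpos.le) fun p => by
    split_ifs with hp
    · exact hp₀min p hp
    · exact hc.nonneg p
  have hdp₀ : d p₀ = 0 := by simp [d, hp₀]
  have hsub : Function.support d ⊆ Function.support c := fun p hp hcp => hp <| by
    simp [d, hcp, show p ∉ L from fun h => hLc p h hcp]
  have hssub : Function.support d ⊂ Function.support c :=
    Set.ssubset_iff_exists.2 ⟨hsub, p₀, hLc p₀ hp₀, fun h => h hdp₀⟩
  obtain ⟨S, w, hS, hw, hSd⟩ := ih _ (hn ▸ Set.ncard_lt_ncard hssub) hd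
    (fun p hp q hq => hclique p (hsub hp) q (hsub hq)) rfl
  exact hS.exists_layerSum_eq_of_add hw hL hpos hSd (fun p hp => by simp [d, hp])
    (fun p hp => by simp [d, hp]) hd.nonneg hclique (fun M hM hMc => hleast M ⟨hM, hMc⟩)
    ⟨p₀, hp₀, hdp₀⟩

end Framing

end Augmentation

/-! ### Flows of the graph and of its augmentation -/

namespace MultiDigraph

variable {V E : Type*} {G : MultiDigraph V E} {p : G.Route} {e : E}

theorem Route.exists_mem_tail_eq_start (hp : p.edges ≠ []) : ∃ e ∈ p.edges, G.tail e = p.start := by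
  obtain ⟨e, l, hl⟩ := List.exists_cons_of_ne_nil hp
  have hpath := p.isPath
  rw [hl] at hpath
  exact ⟨e, by simp [hl], hpath.1⟩

theorem Route.exists_mem_head_eq_finish (hp : p.edges ≠ []) :
    ∃ e ∈ p.edges, G.head e = p.finish := by
  obtain ⟨e, he, h⟩ := p.reverse.exists_mem_tail_eq_start (mt List.reverse_eq_nil_iff.1 hp)
  exact ⟨e, List.mem_reverse.1 he, h⟩

theorem Route.finish_eq_head (he : e ∈ p.edges) (h : G.IsSink (G.head e)) :
    p.finish = G.head e := by
  obtain ⟨l₁, l₂, hl⟩ := List.append_of_mem he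
  obtain ⟨-, h₂⟩ := isPath_append_cons.1 (hl ▸ p.isPath)
  cases l₂ with
  | nil => exact h₂.symm
  | cons f l => exact (h f h₂.1).elim

theorem Route.start_eq_tail (he : e ∈ p.edges) (h : G.IsSource (G.tail e)) :
    p.start = G.tail e :=
  p.reverse.finish_eq_head (List.mem_reverse.2 he) h

section CarriedFlow

variable [Fintype E] {r s : E → E → Prop} {F : E → ℝ}

theorem Route.carriedFlow_eq_zero_of_edges_eq_nil (hp : p.edges = []) :
    p.carriedFlow r s F = 0 := by
  rw [carriedFlow, hp, followWeight_nil]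

theorem Route.pos_of_carriedFlow_ne_zero (hp : p.carriedFlow r s F ≠ 0) (he : e ∈ p.edges) :
    0 < F e := by
  obtain ⟨y, hy⟩ := exists_follows_of_followWeight_ne_zero hp
  obtain ⟨l₁, l₂, hl⟩ := List.append_of_mem he
  rw [hl, follows_append] at hy
  obtain ⟨-, ⟨hle, hlt⟩, -⟩ := hy
  linarith

theorem Route.carriedFlow_mem {H : AddSubgroup ℝ} (hF : ∀ e, F e ∈ H) :
    p.carriedFlow r s F ∈ H :=
  followWeight_mem (fun _ => H.sum_mem fun g _ => hF g) (fun _ => H.sum_mem fun g _ => hF g) hF _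

theorem eq_zero_of_isSource [DecidableEq V] (hF : ∀ e, 0 ≤ F e) {v : V}
    (hv : G.IsSource v) (hbalance : ∑ g with G.head g = v, F g = ∑ g with G.tail g = v, F g)
    (he : G.tail e = v) : F e = 0 := by
  rw [Finset.filter_false_of_mem fun g _ => hv g, Finset.sum_empty, eq_comm,
    Finset.sum_eq_zero_iff_of_nonneg fun g _ => hF g] at hbalance
  exact hbalance e (by simp [he])

theorem eq_zero_of_isSink [DecidableEq V] (hF : ∀ e, 0 ≤ F e) {v : V} (hv : G.IsSink v)
    (hbalance : ∑ g with G.head g = v, F g = ∑ g with G.tail g = v, F g)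
    (he : G.head e = v) : F e = 0 :=
  eq_zero_of_isSource (G := G.reverse) hF hv hbalance.symm he

end CarriedFlow

end MultiDigraph

namespace Augmentation

open MultiDigraph

variable {V E VX VY EX EY : Type*} [Fintype EX] [Fintype EY]
  {G : MultiDigraph V E} {a : V → ℤ} {A : Augmentation G a VX VY EX EY}

/-- The extension of a flow of `G` with netflow `t • a` to the augmented graph: the inflow and
outflow edges carry the netflow of the inflow and outflow vertices, multiplied by `t`. -/
noncomputable def augFlow (A : Augmentation G a VX VY EX EY) (f : E → ℝ) (t : ℝ) :
    E ⊕ EX ⊕ EY → ℝ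
  | .inl e => f e
  | .inr (.inl _) => t
  | .inr (.inr y) => t * |A.aY (A.yHead y)|

theorem augFlow_nonneg {f : E → ℝ} (hf : ∀ e, 0 ≤ f e) {t : ℝ} (ht : 0 ≤ t) (e : E ⊕ EX ⊕ EY) :
    0 ≤ A.augFlow f t e := by
  rcases e with e | _ | y
  · exact hf e
  · exact ht
  · exact mul_nonneg ht (by exact_mod_cast abs_nonneg _)

theorem augFlow_mem {H : AddSubgroup ℝ} {f : E → ℝ} (hf : ∀ e, f e ∈ H) {t : ℝ} (ht : t ∈ H)
    (e : E ⊕ EX ⊕ EY) : A.augFlow f t e ∈ H := by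
  rcases e with e | _ | y
  · exact hf e
  · exact ht
  · rw [augFlow, mul_comm, ← zsmul_eq_mul]
    exact H.zsmul_mem ht _

open Classical in
theorem card_xHead_eq_posPart (v : V) :
    ((Finset.univ.filter fun x => A.xHead x = v).card : ℤ) = (a v)⁺ := by
  rcases lt_or_ge 0 (a v) with hv | hv
  · rw [posPart_of_nonneg hv.le, A.card_xHead v hv]
  · rw [posPart_of_nonpos hv, Finset.filter_false_of_mem, Finset.card_empty, Nat.cast_zero]
    rintro x - rfl
    exact hv.not_gt (A.xHead_pos x)

open Classical in
theorem sum_abs_aY_eq_negPart (v : V) :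
    ∑ y with A.yTail y = v, |A.aY (A.yHead y)| = (a v)⁻ := by
  rcases lt_or_ge (a v) 0 with hv | hv
  · rw [negPart_of_nonpos hv.le, A.sum_aY v hv, ← Finset.sum_neg_distrib]
    exact Finset.sum_congr rfl fun y _ => abs_of_neg (A.aY_neg _)
  · rw [negPart_of_nonneg hv, Finset.filter_false_of_mem, Finset.sum_empty]
    rintro y - rfl
    exact hv.not_gt (A.yTail_neg y)

section Netflow

variable [Fintype E]

open Classical in
theorem sum_tail_augFlow (f : E → ℝ) (t : ℝ) (v : V) :
    ∑ e with A.graph.tail e = .inl v, A.augFlow f t e =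
      (∑ e with G.tail e = v, f e) + t * ((a v)⁻ : ℤ) := by
  rw [← A.sum_abs_aY_eq_negPart v, Int.cast_sum, Finset.mul_sum, Finset.sum_filter,
    Fintype.sum_sum_type, Fintype.sum_sum_type]
  simp [Finset.sum_filter, graph, augFlow]

open Classical in
theorem sum_head_augFlow (f : E → ℝ) (t : ℝ) (v : V) :
    ∑ e with A.graph.head e = .inl v, A.augFlow f t e =
      (∑ e with G.head e = v, f e) + t * ((a v)⁺ : ℤ) := by
  rw [← A.card_xHead_eq_posPart v, Finset.sum_filter, Fintype.sum_sum_type, Fintype.sum_sum_type]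
  simp [← Finset.sum_filter, graph, augFlow, mul_comm t]

open Classical in
theorem sum_head_augFlow_eq_sum_tail_iff {f : E → ℝ} {t : ℝ} {v : V} :
    ∑ e with A.graph.head e = .inl v, A.augFlow f t e =
        ∑ e with A.graph.tail e = .inl v, A.augFlow f t e ↔
      (∑ e with G.tail e = v, f e) - (∑ e with G.head e = v, f e) = t * a v := by
  have hparts : (((a v)⁺ : ℤ) : ℝ) - ((a v)⁻ : ℤ) = a v := by
    exact_mod_cast posPart_sub_negPart (a v)
  rw [sum_head_augFlow, sum_tail_augFlow, ← hparts, mul_sub]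
  constructor <;> intro h <;> linarith

open Classical in
theorem isConserved_augFlow {f : E → ℝ} {t : ℝ}
    (hf : ∀ v, (∑ e with G.tail e = v, f e) - (∑ e with G.head e = v, f e) = t * a v) :
    A.graph.IsConserved (A.augFlow f t) := by
  rintro (v | s | y) hsource hsink
  · convert sum_head_augFlow_eq_sum_tail_iff.2 (hf v)
  · exact (hsource (isSource_inflow s)).elim
  · exact (hsink (isSink_outflow y)).elim

end Netflow

theorem inflow_mem_edges_iff {p : A.graph.Route} {x : EX} :
    .inr (.inl x) ∈ p.edges ↔ p.start = .inr (.inl (A.xTail x)) := by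
  refine ⟨fun h => p.start_eq_tail h (isSource_inflow _), fun h => ?_⟩
  have hne : p.edges ≠ [] := fun hnil => by
    have hpath := p.isPath
    rw [hnil, h] at hpath
    exact not_isSink_inflow _ (hpath ▸ p.isSink_finish)
  obtain ⟨e, he, htail⟩ := p.exists_mem_tail_eq_start hne
  obtain ⟨x', rfl, hx'⟩ := exists_of_tail_eq_inflow (htail.trans h)
  rwa [(A.existsUnique_x _).unique hx' rfl] at he

theorem outflow_mem_edges_iff {p : A.graph.Route} {y : EY} :
    .inr (.inr y) ∈ p.edges ↔ p.finish = .inr (.inr (A.yHead y)) := by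
  refine ⟨fun h => p.finish_eq_head h (isSink_outflow _), fun h => ?_⟩
  have hne : p.edges ≠ [] := fun hnil => by
    have hpath : p.start = p.finish := by simpa [hnil, IsPath] using p.isPath
    exact not_isSource_outflow _ (h ▸ hpath ▸ p.isSource_start)
  obtain ⟨e, he, hhead⟩ := p.exists_mem_head_eq_finish hne
  obtain ⟨y', rfl, hy'⟩ := exists_of_head_eq_outflow (hhead.trans h)
  rwa [(A.existsUnique_y _).unique hy' rfl] at he

theorem isThrough_of_carriedFlow_ne_zero [Fintype E] {F : A.Framing} {f : E → ℝ}
    (hf : f ∈ G.flowPolytope a) {p : A.graph.Route}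
    (hp : p.carriedFlow F.OutLT F.IncLT (A.augFlow f 1) ≠ 0) : IsThrough p := by
  classical
  have hnonneg := A.augFlow_nonneg hf.1 zero_le_one
  have hbalance (v : V) := (sum_head_augFlow_eq_sum_tail_iff (A := A) (t := 1)).2
    ((hf.2 v).trans (one_mul _).symm)
  have hne : p.edges ≠ [] := fun h => hp (Route.carriedFlow_eq_zero_of_edges_eq_nil h)
  constructor
  · obtain ⟨e, he, htail⟩ := p.exists_mem_tail_eq_start hne
    rcases hs : p.start with v | s | y
    · rw [hs] at htail
      refine ((Route.pos_of_carriedFlow_ne_zero hp he).ne' ?_).elim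
      exact eq_zero_of_isSource hnonneg (hs ▸ p.isSource_start) (hbalance v) htail
    · exact ⟨s, rfl⟩
    · exact (not_isSource_outflow y (hs ▸ p.isSource_start)).elim
  · obtain ⟨e, he, hhead⟩ := p.exists_mem_head_eq_finish hne
    rcases hs : p.finish with v | s | y
    · rw [hs] at hhead
      refine ((Route.pos_of_carriedFlow_ne_zero hp he).ne' ?_).elim
      exact eq_zero_of_isSink hnonneg (hs ▸ p.isSink_finish) (hbalance v) hhead
    · exact (not_isSink_inflow s (hs ▸ p.isSink_finish)).elim
    · exact ⟨y, rfl⟩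

section IsBalanced

variable [Fintype A.graph.Route] {c : A.graph.Route → ℝ} {t : ℝ}

open Classical in
theorem routeFlow_inflow (c : A.graph.Route → ℝ) (x : EX) :
    routeFlow c (.inr (.inl x)) = ∑ p with p.start = .inr (.inl (A.xTail x)), c p :=
  Finset.sum_congr (by ext; simp [inflow_mem_edges_iff]) fun _ _ => rfl

open Classical in
theorem routeFlow_outflow (c : A.graph.Route → ℝ) (y : EY) :
    routeFlow c (.inr (.inr y)) = ∑ p with p.finish = .inr (.inr (A.yHead y)), c p :=
  Finset.sum_congr (by ext; simp [outflow_mem_edges_iff]) fun _ _ => rfl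

theorem IsBalanced.routeFlow_eq (hc : IsBalanced c t) :
    routeFlow c = A.augFlow (fun e => routeFlow c (.inl e)) t := by
  ext e
  rcases e with e | x | y
  · rfl
  · rw [routeFlow_inflow, hc.sum_start, augFlow]
  · rw [routeFlow_outflow, hc.sum_finish, augFlow]

open Classical in
theorem IsBalanced.netflow_routeFlow [Fintype E] (hG : G.IsDAG) (hc : IsBalanced c t) (v : V) :
    (∑ e with G.tail e = v, routeFlow c (.inl e)) -
      (∑ e with G.head e = v, routeFlow c (.inl e)) = t * a v := by
  rw [← sum_head_augFlow_eq_sum_tail_iff (A := A), ← hc.routeFlow_eq]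
  convert sum_head_routeFlow_eq_sum_tail (isDAG_graph hG) fun p hp => ?_
  obtain ⟨⟨s, hs⟩, y, hy⟩ := hc.isThrough p hp
  simp [hs, hy]

variable [Finite V] [Fintype E] {F : A.Framing} {f : E → ℝ}

theorem routeFlow_carriedFlow_augFlow [Finite VX] [Finite VY] (hG : G.IsDAG)
    (hf : f ∈ G.flowPolytope a) (e : E ⊕ EX ⊕ EY) :
    routeFlow (Route.carriedFlow (G := A.graph) F.OutLT F.IncLT (A.augFlow f 1)) e =
      A.augFlow f 1 e :=
  routeFlow_carriedFlow (isDAG_graph hG) F.isFiberOrder_outLT F.isFiberOrder_incLT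
    (augFlow_nonneg hf.1 zero_le_one)
    (isConserved_augFlow fun v => (hf.2 v).trans (one_mul _).symm) e

theorem isBalanced_carriedFlow [Finite VX] [Finite VY] (hG : G.IsDAG)
    (hf : f ∈ G.flowPolytope a) :
    IsBalanced (Route.carriedFlow (G := A.graph) F.OutLT F.IncLT (A.augFlow f 1)) 1 where
  nonneg p := followWeight_nonneg _
  isThrough p := isThrough_of_carriedFlow_ne_zero hf
  sum_start s := by
    obtain ⟨x, rfl, -⟩ := A.existsUnique_x s
    rw [← routeFlow_inflow, routeFlow_carriedFlow_augFlow hG hf, augFlow]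
  sum_finish v := by
    obtain ⟨y, rfl, -⟩ := A.existsUnique_y v
    rw [← routeFlow_outflow, routeFlow_carriedFlow_augFlow hG hf, augFlow]

end IsBalanced

end Augmentation

namespace Augmentation

open MultiDigraph

variable {V E VX VY EX EY : Type*} [Fintype EX] [Fintype EY]
  {G : MultiDigraph V E} {a : V → ℤ} {A : Augmentation G a VX VY EX EY}

open Classical in
theorem layeringIndicator_apply (L : Finset A.graph.Route) (e : E) :
    A.layeringIndicator L e = (L.filter fun p => .inl e ∈ p.edges).card := by
  simp [layeringIndicator, routeIndicator]

theorem isIntegerPoint_layeringIndicator (L : Finset A.graph.Route) :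
    IsIntegerPoint (A.layeringIndicator L) := by
  classical
  exact fun e => ⟨(L.filter fun p => .inl e ∈ p.edges).card, by simp [layeringIndicator_apply]⟩

theorem routeFlow_layerSum [Fintype A.graph.Route] (S : Finset (Finset A.graph.Route))
    (w : Finset A.graph.Route → ℝ) (e : E) :
    routeFlow (layerSum S w) (.inl e) = (∑ L ∈ S, w L • A.layeringIndicator L) e := by
  classical
  simp only [routeFlow, layerSum, Finset.sum_apply, Pi.smul_apply, smul_eq_mul,
    Finset.sum_filter _ (w ·)]
  rw [Finset.sum_comm]
  refine Finset.sum_congr rfl fun L _ => ?_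
  rw [← Finset.sum_filter, Finset.filter_filter, Finset.sum_const, layeringIndicator_apply,
    nsmul_eq_mul, mul_comm]
  congr 3
  ext
  simp [and_comm]

theorem sum_smul_layeringIndicator_mem_flowPolytope [Fintype E] [Finite A.graph.Route]
    (hG : G.IsDAG) {S : Finset (Finset A.graph.Route)} (hS : ∀ L ∈ S, A.IsLayering L)
    {w : Finset A.graph.Route → ℝ} (hw : ∀ L ∈ S, 0 ≤ w L) (hw1 : ∑ L ∈ S, w L = 1) :
    ∑ L ∈ S, w L • A.layeringIndicator L ∈ G.flowPolytope a := by
  have := Fintype.ofFinite A.graph.Route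
  have hbalanced := isBalanced_layerSum hS hw
  refine ⟨fun e => ?_, fun v => ?_⟩
  · rw [← routeFlow_layerSum]
    exact Finset.sum_nonneg fun p _ => hbalanced.nonneg p
  · simpa only [routeFlow_layerSum, hw1, one_mul] using hbalanced.netflow_routeFlow hG v

namespace Framing

variable {F : A.Framing}

theorem exists_isLayeringSimplex_of_mem_flowPolytope [Finite V] [Finite VX] [Finite VY]
    [Nonempty VX] [Fintype E] [Finite A.graph.Route] (hG : G.IsDAG) {f : E → ℝ}
    (hf : f ∈ G.flowPolytope a) :
    ∃ (S : Finset (Finset A.graph.Route)) (w : Finset A.graph.Route → ℝ),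
      F.IsLayeringSimplex S ∧ (∀ L ∈ S, 0 < w L) ∧ ∑ L ∈ S, w L = 1 ∧
      ∑ L ∈ S, w L • A.layeringIndicator L = f := by
  have := Fintype.ofFinite A.graph.Route
  have hbalanced := isBalanced_carriedFlow (F := F) hG hf
  obtain ⟨S, w, hS, hw, hSw⟩ := exists_layerSum_eq hbalanced <| isRouteClique_iff.2 <|
    isNoncrossing_support_carriedFlow F.isFiberOrder_outLT F.isFiberOrder_incLT
      (augFlow_nonneg hf.1 zero_le_one)
  refine ⟨S, w, hS, hw, ?_, funext fun e => ?_⟩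
  · have hbalanced' := isBalanced_layerSum hS.isLayering fun L hL => (hw L hL).le
    rw [← hbalanced'.sum_start (Classical.arbitrary VX), hSw, hbalanced.sum_start]
  · rw [← routeFlow_layerSum, hSw, routeFlow_carriedFlow_augFlow hG hf, augFlow]

variable {S T : Finset (Finset A.graph.Route)} {v w : Finset A.graph.Route → ℝ}

theorem IsLayeringSimplex.layerSum_eq_carriedFlow [Finite V] [Finite VX] [Finite VY] [Fintype E]
    [Finite A.graph.Route] (hG : G.IsDAG) (hS : F.IsLayeringSimplex S) (hw : ∀ L ∈ S, 0 < w L)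
    (p : A.graph.Route) : layerSum S w p = p.carriedFlow F.OutLT F.IncLT
      (A.augFlow (∑ L ∈ S, w L • A.layeringIndicator L) (∑ L ∈ S, w L)) := by
  have := Fintype.ofFinite A.graph.Route
  have hbalanced := isBalanced_layerSum hS.isLayering fun L hL => (hw L hL).le
  by_cases hp : p.edges = []
  · rw [Route.carriedFlow_eq_zero_of_edges_eq_nil hp]
    by_contra hne
    exact (hbalanced.isThrough p hne).edges_ne_nil hp
  · have hclique : F.IsRouteClique (Function.support (layerSum S w)) := fun p hp q hq =>
      hS.isRouteClique p ((layerSum_ne_zero_iff hw).1 hp) q ((layerSum_ne_zero_iff hw).1 hq)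
    rw [← carriedFlow_routeFlow (isDAG_graph hG) F.isFiberOrder_outLT F.isFiberOrder_incLT
      hbalanced.nonneg (isRouteClique_iff.1 hclique) hp, hbalanced.routeFlow_eq]
    simp only [routeFlow_layerSum]

theorem IsLayeringSimplex.eq_of_sum_eq [Finite V] [Finite VX] [Finite VY] [Finite E]
    [Finite A.graph.Route] (hG : G.IsDAG) (hS : F.IsLayeringSimplex S) (hT : F.IsLayeringSimplex T)
    (hv : ∀ L ∈ S, 0 < v L) (hw : ∀ L ∈ T, 0 < w L) (hvw : ∑ L ∈ S, v L = ∑ L ∈ T, w L)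
    (h : ∑ L ∈ S, v L • A.layeringIndicator L = ∑ L ∈ T, w L • A.layeringIndicator L) :
    S = T ∧ ∀ L ∈ S, v L = w L :=
  have := Fintype.ofFinite E
  hS.layerSum_inj hT hv hw fun p => by
    rw [hS.layerSum_eq_carriedFlow hG hv, hT.layerSum_eq_carriedFlow hG hw, hvw, h]

section Integrality

variable {H : AddSubgroup ℝ}

theorem IsLayeringSimplex.mem_of_layerSum_mem [Finite VX] [Finite A.graph.Route]
    (hS : F.IsLayeringSimplex S) (h : ∀ p, layerSum S w p ∈ H) : ∀ L ∈ S, w L ∈ H := by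
  classical
  induction S using Finset.strongInduction with
  | H S ih =>
    rcases S.eq_empty_or_nonempty with rfl | hne
    · simp
    obtain ⟨L, hL, hleast⟩ := hS.exists_least hne
    obtain ⟨p, hp, hpL⟩ := hS.exists_layerSum_eq_of_least (w := w) hL hleast
    have hwL : w L ∈ H := hpL ▸ h p
    rw [← Finset.insert_erase hL] at h ⊢
    refine Finset.forall_mem_insert _ _ _ |>.2 ⟨hwL, ih _ (Finset.erase_ssubset hL)
      (hS.mono (S.erase_subset L)) fun q => ?_⟩
    have hq := h q
    rw [layerSum_insert (S.notMem_erase L)] at hq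
    refine (H.add_mem_cancel_left ?_).1 hq
    split_ifs
    · exact hwL
    · exact H.zero_mem

variable [Finite V] [Finite VX] [Finite VY] [Finite E] [Finite A.graph.Route]

theorem IsLayeringSimplex.mem_of_sum_mem_of_pos (hG : G.IsDAG) (hS : F.IsLayeringSimplex S)
    (hw : ∀ L ∈ S, 0 < w L) (hsum : ∑ L ∈ S, w L ∈ H)
    (h : ∀ e, (∑ L ∈ S, w L • A.layeringIndicator L) e ∈ H) : ∀ L ∈ S, w L ∈ H :=
  have := Fintype.ofFinite E
  hS.mem_of_layerSum_mem fun p => by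
    rw [hS.layerSum_eq_carriedFlow hG hw]
    exact Route.carriedFlow_mem (augFlow_mem h hsum)

-- Adding a large natural number to all coefficients makes them positive.
theorem IsLayeringSimplex.mem_of_sum_mem (hG : G.IsDAG) (hS : F.IsLayeringSimplex S)
    (hone : 1 ∈ H) (hsum : ∑ L ∈ S, w L ∈ H)
    (h : ∀ e, (∑ L ∈ S, w L • A.layeringIndicator L) e ∈ H) : ∀ L ∈ S, w L ∈ H := by
  classical
  obtain ⟨N, hN⟩ := exists_nat_gt (∑ L ∈ S, |w L|)
  have hpos : ∀ L ∈ S, 0 < w L + N := fun L hL => by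
    have hle := Finset.single_le_sum (f := fun L => |w L|) (fun L _ => abs_nonneg (w L)) hL
    linarith [neg_abs_le (w L)]
  have hnat (n : ℕ) : (n : ℝ) ∈ H := by simpa using H.nsmul_mem hone n
  have hshift := hS.mem_of_sum_mem_of_pos (w := fun L => w L + N) hG hpos
    (by
      rw [Finset.sum_add_distrib]
      exact H.add_mem hsum (H.sum_mem fun _ _ => hnat N))
    fun e => by
      simp only [add_smul, Finset.sum_add_distrib, Pi.add_apply]
      refine H.add_mem (h e) ?_
      simp only [Finset.sum_apply, Pi.smul_apply, layeringIndicator_apply, smul_eq_mul,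
        ← Nat.cast_mul]
      exact H.sum_mem fun _ _ => hnat _
  exact fun L hL => (H.add_mem_cancel_right (hnat N)).1 (hshift L hL)

end Integrality

end Framing

end Augmentation

/-! ### The volume of unimodular simplices -/

section Volume

open MeasureTheory

/-- The simplex with the vertices `0` and `r • eᵢ`, the model of a unimodular simplex when
`r = 1`. -/
def cornerSimplex (ι : Type*) [Fintype ι] (r : ℝ) : Set (ι → ℝ) :=
  {x | (∀ i, 0 ≤ x i) ∧ ∑ i, x i ≤ r}

theorem isClosed_cornerSimplex (ι : Type*) [Fintype ι] (r : ℝ) :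
    IsClosed (cornerSimplex ι r) := by
  simp only [cornerSimplex, Set.ofPred_and, Set.ofPred_forall]
  exact (isClosed_iInter fun i => isClosed_le continuous_const (continuous_apply i)).inter
    (isClosed_le (by fun_prop) continuous_const)

theorem cornerSimplex_eq_empty (ι : Type*) [Fintype ι] {r : ℝ} (hr : r < 0) :
    cornerSimplex ι r = ∅ :=
  Set.eq_empty_of_forall_notMem fun _ hx =>
    hr.not_ge ((Finset.sum_nonneg fun i _ => hx.1 i).trans hx.2)

theorem cons_mem_cornerSimplex_iff {n : ℕ} {r t : ℝ} {y : Fin n → ℝ} :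
    (Fin.cons t y : Fin (n + 1) → ℝ) ∈ cornerSimplex (Fin (n + 1)) r ↔
      0 ≤ t ∧ y ∈ cornerSimplex (Fin n) (r - t) := by
  simp [cornerSimplex, Fin.forall_fin_succ, Fin.sum_univ_succ, le_sub_iff_add_le', and_assoc]

theorem lintegral_Icc_sub_pow_div_factorial (n : ℕ) {r : ℝ} (hr : 0 ≤ r) :
    ∫⁻ t in Set.Icc 0 r, ENNReal.ofReal ((r - t) ^ n / n.factorial) =
      ENNReal.ofReal (r ^ (n + 1) / (n + 1).factorial) := by
  have hnonneg : ∀ t ∈ Set.Icc 0 r, 0 ≤ (r - t) ^ n / n.factorial := fun t ht => by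
    have := sub_nonneg.2 ht.2
    positivity
  rw [← ofReal_integral_eq_lintegral_ofReal (Continuous.integrableOn_Icc (by fun_prop))
    (ae_restrict_of_forall_mem measurableSet_Icc hnonneg), integral_Icc_eq_integral_Ioc,
    ← intervalIntegral.integral_of_le hr, intervalIntegral.integral_div,
    intervalIntegral.integral_comp_sub_left (fun x => x ^ n), sub_self, sub_zero, integral_pow,
    zero_pow n.succ_ne_zero, sub_zero, div_div, Nat.factorial_succ]
  push_cast
  rfl

theorem volume_cornerSimplex_fin_succ (n : ℕ) (r : ℝ) :
    volume (cornerSimplex (Fin (n + 1)) r) =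
      ∫⁻ t in Set.Icc 0 r, volume (cornerSimplex (Fin n) (r - t)) := by
  let e := MeasurableEquiv.piFinSuccAbove (fun _ : Fin (n + 1) => ℝ) 0
  have hmeas := (isClosed_cornerSimplex (Fin (n + 1)) r).measurableSet
  rw [← (volume_preserving_piFinSuccAbove (fun _ : Fin (n + 1) => ℝ) 0).symm.measure_preimage
    hmeas.nullMeasurableSet, Measure.volume_eq_prod, Measure.prod_apply (e.symm.measurable hmeas),
    ← lintegral_indicator measurableSet_Icc]
  refine lintegral_congr fun t => ?_
  have hslice : Prod.mk t ⁻¹' (e.symm ⁻¹' cornerSimplex (Fin (n + 1)) r) =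
      {y | 0 ≤ t ∧ y ∈ cornerSimplex (Fin n) (r - t)} := by
    ext y
    simp only [Set.mem_preimage, Set.mem_ofPred_eq, ← cons_mem_cornerSimplex_iff]
    simp [e, MeasurableEquiv.piFinSuccAbove, Fin.consEquiv]
  rw [hslice]
  by_cases ht₀ : 0 ≤ t
  · by_cases htr : t ≤ r
    · simp [ht₀, htr]
    · simp [htr, cornerSimplex_eq_empty (Fin n) (sub_neg.2 (not_le.1 htr))]
  · simp [ht₀]

theorem volume_cornerSimplex_fin (n : ℕ) {r : ℝ} (hr : 0 ≤ r) :
    volume (cornerSimplex (Fin n) r) = ENNReal.ofReal (r ^ n / n.factorial) := by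
  induction n generalizing r with
  | zero => simp [cornerSimplex, hr, volume_pi]
  | succ n ih =>
    rw [volume_cornerSimplex_fin_succ, ← lintegral_Icc_sub_pow_div_factorial n hr]
    exact setLIntegral_congr_fun measurableSet_Icc fun t ht => ih (sub_nonneg.2 ht.2)

theorem volume_real_cornerSimplex (ι : Type*) [Fintype ι] {r : ℝ} (hr : 0 ≤ r) :
    volume.real (cornerSimplex ι r) = r ^ Fintype.card ι / (Fintype.card ι).factorial := by
  let e := Fintype.equivFin ι
  have hpre : ⇑(MeasurableEquiv.arrowCongr' e (MeasurableEquiv.refl ℝ)) ⁻¹'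
      cornerSimplex (Fin (Fintype.card ι)) r = cornerSimplex ι r := by
    ext x
    exact and_congr (e.symm.forall_congr_right (q := fun i => 0 ≤ x i))
      (by rw [← e.symm.sum_comp x]; rfl)
  have hmeas := (isClosed_cornerSimplex (Fin (Fintype.card ι)) r).measurableSet
  rw [measureReal_def, ← hpre, (volume_preserving_arrowCongr' e (MeasurableEquiv.refl ℝ)
    (MeasurePreserving.id volume)).measure_preimage hmeas.nullMeasurableSet,
    volume_cornerSimplex_fin _ hr, ENNReal.toReal_ofReal (by positivity)]

theorem measureReal_preimage_equivFun {W ι : Type*} [Fintype ι] [NormedAddCommGroup W]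
    [NormedSpace ℝ W] [MeasurableSpace W] [BorelSpace W] (b : Module.Basis ι ℝ W) (μ : Measure W)
    [μ.IsAddHaarMeasure] (s : Set (ι → ℝ)) :
    μ.real (b.equivFun ⁻¹' s) = μ.real (ZSpan.fundamentalDomain b) * volume.real s := by
  have : FiniteDimensional ℝ W := b.finiteDimensional_of_finite
  let e := b.equivFunL
  obtain ⟨c, hc⟩ : ∃ c : NNReal, μ.map e = c • volume :=
    ⟨_, Measure.isAddLeftInvariant_eq_smul (μ.map e) volume⟩
  have hscale (s : Set (ι → ℝ)) : μ.real (e ⁻¹' s) = c * volume.real s := by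
    rw [← measureReal_nnreal_smul_apply, ← hc]
    exact congrArg ENNReal.toReal (e.toHomeomorph.toMeasurableEquiv.map_apply s).symm
  have hcube : ZSpan.fundamentalDomain b = e ⁻¹' (Set.univ.pi fun _ => Set.Ico 0 1) := by
    ext w
    simp [ZSpan.mem_fundamentalDomain, e]
  have hfund : μ.real (ZSpan.fundamentalDomain b) = c := by
    rw [hcube, hscale, measureReal_def, volume_pi_pi]
    simp
  rw [hfund]
  exact hscale s

section Lattice

variable {E : Type*} [Fintype E] {W : Submodule ℝ (E → ℝ)}

set_option synthInstance.maxHeartbeats 200000 in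
-- The instances on the subspace `W` of `E → ℝ` are slow to synthesize.
theorem latticeVolume_preimage_equivFun {ι : Type*} [Fintype ι] (b : Module.Basis ι ℝ W)
    (hb : integerPoints W = Submodule.span ℤ (Set.range b)) (s : Set (ι → ℝ)) :
    latticeVolume W (b.equivFun ⁻¹' s) = volume.real s := by
  have hcov := ZLattice.covolume_eq_measure_fundamentalDomain _ _
    (ZSpan.isAddFundamentalDomain b (Measure.addHaar : Measure W))
  have hpos := ZLattice.covolume_ne_zero (Submodule.span ℤ (Set.range b))
    (Measure.addHaar : Measure W)
  rw [latticeVolume, hb, measureReal_preimage_equivFun, ← hcov, mul_div_cancel_left₀ _ hpos]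

set_option synthInstance.maxHeartbeats 200000 in
-- The instances on the subspace `W` of `E → ℝ` are slow to synthesize.
theorem latticeVolume_preimage_add_right (w : W) (s : Set W) :
    latticeVolume W ((· + w) ⁻¹' s) = latticeVolume W s := by
  rw [latticeVolume, measureReal_def, measure_preimage_add_right, ← measureReal_def, latticeVolume]

end Lattice

section Simplex

variable {κ M : Type*} [AddCommGroup M] [Module ℝ M]

theorem mem_convexHull_range_iff [Fintype κ] {p : κ → M} {x : M} :
    x ∈ convexHull ℝ (Set.range p) ↔ ∃ w ∈ stdSimplex ℝ κ, ∑ i, w i • p i = x := by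
  classical
  have hrange : Set.range p =
      Fintype.linearCombination ℝ p '' Set.range fun i => Pi.single i (1 : ℝ) := by
    rw [← Set.range_comp]
    congr 1
    ext i
    simp
  rw [hrange, ← LinearMap.image_convexHull, convexHull_rangle_single_eq_stdSimplex]
  rfl

theorem mem_convexHull_image_iff {S : Finset κ} {p : κ → M} {x : M} :
    x ∈ convexHull ℝ (p '' S) ↔
      ∃ w : κ → ℝ, (∀ i ∈ S, 0 ≤ w i) ∧ ∑ i ∈ S, w i = 1 ∧ ∑ i ∈ S, w i • p i = x := by
  constructor
  · rw [Set.image_eq_range, mem_convexHull_range_iff]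
    rintro ⟨u, ⟨hu, hu1⟩, rfl⟩
    have hext := Subtype.val_injective.extend_apply u (0 : κ → ℝ)
    refine ⟨Function.extend Subtype.val u 0, fun i hi => (hu ⟨i, hi⟩).trans_eq
      (hext ⟨i, hi⟩).symm, ?_, ?_⟩
    · rw [← Finset.sum_coe_sort, ← hu1]
      exact Finset.sum_congr rfl fun i _ => hext i
    · rw [← Finset.sum_coe_sort]
      exact Finset.sum_congr rfl fun i _ => by rw [hext i]
  · rintro ⟨w, hw, hw1, rfl⟩
    exact (convex_convexHull ℝ _).sum_mem hw hw1 fun i hi => subset_convexHull _ _ ⟨i, hi, rfl⟩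

/-- The basis of the direction of a simplex formed by its edge vectors at the vertex `p i₀`, the
lattice basis in which a unimodular simplex becomes `cornerSimplex`. -/
noncomputable def edgeBasis {p : κ → M} (i₀ : κ) (hp : AffineIndependent ℝ p) :
    Module.Basis {i // i ≠ i₀} ℝ (vectorSpan ℝ (convexHull ℝ (Set.range p))) :=
  (Module.Basis.span ((affineIndependent_iff_linearIndependent_vsub ℝ p i₀).1 hp)).map
    (LinearEquiv.ofEq _ _ (by
      rw [← direction_affineSpan, affineSpan_convexHull, direction_affineSpan,
        vectorSpan_range_eq_span_range_vsub_right_ne ℝ p i₀]))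

theorem coe_edgeBasis {p : κ → M} (i₀ : κ) (hp : AffineIndependent ℝ p) (i : {i // i ≠ i₀}) :
    (edgeBasis i₀ hp i : M) = p i - p i₀ := by
  simp [edgeBasis, Module.Basis.span_apply]

theorem exists_sum_eq_of_ne [Fintype κ] (i₀ : κ) (u : {i // i ≠ i₀} → ℝ) (r : ℝ) :
    ∃ w : κ → ℝ, ∑ i, w i = r ∧ ∀ i : {i // i ≠ i₀}, w i = u i := by
  classical
  have hne (i : {i // i ≠ i₀}) :
      Function.update (Function.extend Subtype.val u 0) i₀ (r - ∑ j, u j) i = u i := by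
    rw [Function.update_of_ne i.2, Subtype.val_injective.extend_apply]
  refine ⟨_, ?_, hne⟩
  rw [Fintype.sum_eq_add_sum_subtype_ne _ i₀, Function.update_self]
  simp only [hne, sub_add_cancel]

variable [Fintype κ] [DecidableEq κ] {p : κ → M} (i₀ : κ)

theorem sum_smul_eq_add_sum_smul_sub (p : κ → M) (w : κ → ℝ) :
    ∑ i, w i • p i = (∑ i, w i) • p i₀ + ∑ i : {i // i ≠ i₀}, w i • (p i - p i₀) := by
  rw [Fintype.sum_eq_add_sum_subtype_ne _ i₀, Fintype.sum_eq_add_sum_subtype_ne _ i₀, add_smul,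
    Finset.sum_smul, add_assoc, ← Finset.sum_add_distrib]
  simp only [← smul_add, add_sub_cancel]

theorem mem_convexHull_range_iff_exists_cornerSimplex {x : M} :
    x ∈ convexHull ℝ (Set.range p) ↔
      ∃ u ∈ cornerSimplex {i // i ≠ i₀} 1, p i₀ + ∑ i, u i • (p i - p i₀) = x := by
  rw [mem_convexHull_range_iff]
  constructor
  · rintro ⟨w, ⟨hw, hw1⟩, rfl⟩
    refine ⟨fun i => w i, ⟨fun i => hw i, ?_⟩, ?_⟩
    · rw [Fintype.sum_eq_add_sum_subtype_ne _ i₀] at hw1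
      linarith [hw i₀]
    · rw [sum_smul_eq_add_sum_smul_sub i₀, hw1, one_smul]
  · rintro ⟨u, ⟨hu, hu1⟩, rfl⟩
    obtain ⟨w, hw1, hwu⟩ := exists_sum_eq_of_ne i₀ u 1
    refine ⟨w, ⟨fun i => ?_, hw1⟩, ?_⟩
    · by_cases hi : i = i₀
      · rw [Fintype.sum_eq_add_sum_subtype_ne _ i₀] at hw1
        simp only [hwu] at hw1
        subst hi
        linarith
      · exact (hu ⟨i, hi⟩).trans_eq (hwu ⟨i, hi⟩).symm
    · simp only [sum_smul_eq_add_sum_smul_sub i₀, hw1, one_smul, hwu]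

theorem sum_equivFun_edgeBasis_smul (hp : AffineIndependent ℝ p)
    (w : vectorSpan ℝ (convexHull ℝ (Set.range p))) :
    ∑ i, (edgeBasis i₀ hp).equivFun w i • (p i - p i₀) = (w : M) := by
  conv_rhs => rw [← (edgeBasis i₀ hp).sum_equivFun w]
  simp only [Submodule.coe_sum, Submodule.coe_smul, coe_edgeBasis]

theorem add_mem_convexHull_range_iff (hp : AffineIndependent ℝ p)
    (w : vectorSpan ℝ (convexHull ℝ (Set.range p))) :
    p i₀ + (w : M) ∈ convexHull ℝ (Set.range p) ↔
      (edgeBasis i₀ hp).equivFun w ∈ cornerSimplex {i // i ≠ i₀} 1 := by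
  rw [mem_convexHull_range_iff_exists_cornerSimplex i₀]
  constructor
  · rintro ⟨u, hu, huw⟩
    rw [add_right_inj] at huw
    suffices hwu : (edgeBasis i₀ hp).equivFun w = u from hwu ▸ hu
    rw [← LinearEquiv.eq_symm_apply, Module.Basis.equivFun_symm_apply]
    ext1
    simp only [Submodule.coe_sum, Submodule.coe_smul, coe_edgeBasis, huw]
  · exact fun hw => ⟨_, hw, by rw [sum_equivFun_edgeBasis_smul]⟩

end Simplex

section Unimodular

variable {E κ : Type*} [Fintype κ] {p : κ → E → ℝ}

theorem integerPoints_eq_span_range_edgeBasis (i₀ : κ)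
    (hp : AffineIndependent ℝ p) (hint : ∀ i, IsIntegerPoint (p i))
    (hcoef : ∀ w : κ → ℝ, ∑ i, w i = 0 → IsIntegerPoint (∑ i, w i • p i) → ∀ i, ∃ n : ℤ, w i = n) :
    integerPoints (vectorSpan ℝ (convexHull ℝ (Set.range p))) =
      Submodule.span ℤ (Set.range (edgeBasis i₀ hp)) := by
  classical
  apply le_antisymm
  · intro w hw
    rw [(edgeBasis i₀ hp).mem_span_iff_repr_mem ℤ]
    intro i
    obtain ⟨u, hu, hui⟩ := exists_sum_eq_of_ne i₀ ((edgeBasis i₀ hp).equivFun w) 0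
    have huw : ∑ i, u i • p i = w := by
      simp only [sum_smul_eq_add_sum_smul_sub i₀, hu, zero_smul, zero_add, hui,
        sum_equivFun_edgeBasis_smul]
    obtain ⟨n, hn⟩ := hcoef u hu (huw ▸ hw) i
    exact ⟨n, by simpa using hn.symm.trans (hui i)⟩
  · rw [Submodule.span_le]
    rintro _ ⟨i, rfl⟩ e
    obtain ⟨m, hm⟩ := hint i e
    obtain ⟨n, hn⟩ := hint i₀ e
    exact ⟨m - n, by simp [coe_edgeBasis, hm, hn]⟩

theorem normalizedVolume_convexHull_eq_one [Fintype E] (hp : AffineIndependent ℝ p)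
    (hint : ∀ i, IsIntegerPoint (p i))
    (hcoef : ∀ w : κ → ℝ, ∑ i, w i = 0 → IsIntegerPoint (∑ i, w i • p i) → ∀ i, ∃ n : ℤ, w i = n)
    {x : E → ℝ} (hx : x ∈ convexHull ℝ (Set.range p)) :
    normalizedVolume (convexHull ℝ (Set.range p)) x = 1 := by
  classical
  obtain ⟨i₀⟩ : Nonempty κ := Set.range_nonempty_iff_nonempty.1 (convexHull_nonempty_iff.1 ⟨x, hx⟩)
  let b := edgeBasis i₀ hp
  let w₀ : vectorSpan ℝ (convexHull ℝ (Set.range p)) :=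
    ⟨x - p i₀, vsub_mem_vectorSpan ℝ hx (subset_convexHull _ _ ⟨i₀, rfl⟩)⟩
  have htranslate : {w : vectorSpan ℝ (convexHull ℝ (Set.range p)) |
      x + (w : E → ℝ) ∈ convexHull ℝ (Set.range p)} =
      (· + w₀) ⁻¹' (b.equivFun ⁻¹' cornerSimplex {i // i ≠ i₀} 1) := by
    ext w
    rw [Set.mem_preimage, Set.mem_preimage, ← add_mem_convexHull_range_iff, Submodule.coe_add,
      add_left_comm, add_sub_cancel, add_comm, Set.mem_ofPred_eq]
  rw [normalizedVolume, htranslate, latticeVolume_preimage_add_right,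
    latticeVolume_preimage_equivFun b (integerPoints_eq_span_range_edgeBasis i₀ hp hint hcoef),
    volume_real_cornerSimplex _ zero_le_one, Module.finrank_eq_card_basis b, one_pow]
  exact mul_one_div_cancel (by positivity)

end Unimodular

end Volume

/-! ### Triangulations from unique positive combinations -/

theorem IsVertexSet.convexHull_extremePoints {E : Type*} {s : Finset (E → ℝ)} {Δ : Set (E → ℝ)}
    (h : IsVertexSet s Δ) : convexHull ℝ (Δ.extremePoints ℝ) = Δ := by
  obtain ⟨-, rfl⟩ := h
  have hfin : ((convexHull ℝ (s : Set (E → ℝ))).extremePoints ℝ).Finite :=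
    s.finite_toSet.subset extremePoints_convexHull_subset
  rw [← (hfin.isClosed_convexHull ℝ).closure_eq]
  exact closure_convexHull_extremePoints (s.finite_toSet.isCompact_convexHull ℝ)
    (convex_convexHull ℝ _)

theorem IsVertexSet.extremePoints_eq {E : Type*} {s : Finset (E → ℝ)} {Δ : Set (E → ℝ)}
    (h : IsVertexSet s Δ) : Δ.extremePoints ℝ = s := by
  have hsub : Δ.extremePoints ℝ ⊆ s := by
    rw [h.2]
    exact extremePoints_convexHull_subset
  refine hsub.antisymm fun x hx => ?_
  have himage : (↑) '' {y : s | (y : E → ℝ) ∈ Δ.extremePoints ℝ} = Δ.extremePoints ℝ :=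
    Subtype.coe_image_of_subset hsub
  have hspan : x ∈ affineSpan ℝ (Δ.extremePoints ℝ) := by
    apply convexHull_subset_affineSpan
    rw [h.convexHull_extremePoints, h.2]
    exact subset_convexHull _ _ hx
  rw [← himage] at hspan
  exact (h.1.mem_affineSpan_iff ⟨x, hx⟩ _).1 hspan

theorem exists_pos_of_mem_convexHull_image {κ M : Type*} [AddCommGroup M] [Module ℝ M]
    {J : κ → M} {S : Finset κ} {x : M} (hx : x ∈ convexHull ℝ (J '' S)) :
    ∃ T ⊆ S, ∃ w : κ → ℝ,
      (∀ i ∈ T, 0 < w i) ∧ ∑ i ∈ T, w i = 1 ∧ ∑ i ∈ T, w i • J i = x := by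
  classical
  obtain ⟨w, hw, hw1, rfl⟩ := mem_convexHull_image_iff.1 hx
  refine ⟨{i ∈ S | w i ≠ 0}, Finset.filter_subset _ _, w, fun i hi => ?_, ?_, ?_⟩
  · rw [Finset.mem_filter] at hi
    exact (hw i hi.1).lt_of_ne' hi.2
  · rw [Finset.sum_filter_ne_zero, hw1]
  · exact Finset.sum_filter_of_ne fun i _ hi h0 => hi (by rw [h0, zero_smul])

/-- The members of `𝒮` index simplices on the points `J i` whose relative interiors are pairwise
disjoint: a positive combination over a member of `𝒮`, together with the sum of its coefficients,
determines that member and the coefficients. -/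
def HasUniqueCombinations {κ M : Type*} [AddCommGroup M] [Module ℝ M] (J : κ → M)
    (𝒮 : Set (Finset κ)) : Prop :=
  ∀ S ∈ 𝒮, ∀ T ∈ 𝒮, ∀ v w : κ → ℝ, (∀ i ∈ S, 0 < v i) → (∀ i ∈ T, 0 < w i) →
    ∑ i ∈ S, v i = ∑ i ∈ T, w i → ∑ i ∈ S, v i • J i = ∑ i ∈ T, w i • J i →
    S = T ∧ ∀ i ∈ S, v i = w i

namespace HasUniqueCombinations

section Module

variable {κ M : Type*} [AddCommGroup M] [Module ℝ M] {J : κ → M} {𝒮 : Set (Finset κ)}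
  {S T : Finset κ}

-- Compare the constant coefficients `N` with `w i + N` for large `N`.
theorem eq_zero (h : HasUniqueCombinations J 𝒮) (hS : S ∈ 𝒮) {w : κ → ℝ}
    (hw : ∑ i ∈ S, w i = 0) (hwJ : ∑ i ∈ S, w i • J i = 0) : ∀ i ∈ S, w i = 0 := by
  let N := ∑ i ∈ S, |w i| + 1
  have hN : 0 < N := add_pos_of_nonneg_of_pos (Finset.sum_nonneg fun i _ => abs_nonneg _) one_pos
  have hpos : ∀ i ∈ S, 0 < w i + N := fun i hi => by
    have hle := Finset.single_le_sum (f := fun i => |w i|) (fun i _ => abs_nonneg (w i)) hi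
    linarith [neg_abs_le (w i)]
  have heq := (h S hS S hS (fun i => w i + N) (fun _ => N) hpos (fun _ _ => hN)
    (by rw [Finset.sum_add_distrib, hw, zero_add])
    (by simp only [add_smul, Finset.sum_add_distrib, hwJ, zero_add])).2
  exact fun i hi => by linarith [heq i hi]

theorem affineIndependent (h : HasUniqueCombinations J 𝒮) (hS : S ∈ 𝒮) :
    AffineIndependent ℝ fun i : S => J i := by
  rw [affineIndependent_iff_of_fintype]
  intro u hu huJ i
  rw [Finset.weightedVSub_eq_linear_combination _ hu] at huJ
  have hext := Subtype.val_injective.extend_apply u (0 : κ → ℝ)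
  rw [← hext]
  refine h.eq_zero hS ?_ ?_ i i.2
  · rw [← Finset.sum_coe_sort]
    simpa only [hext] using hu
  · rw [← Finset.sum_coe_sort S fun i => Function.extend Subtype.val u (0 : κ → ℝ) i • J i]
    simpa only [hext] using huJ

theorem convexHull_inter [DecidableEq κ] (h : HasUniqueCombinations J 𝒮)
    (hdown : ∀ S ∈ 𝒮, ∀ T ⊆ S, T ∈ 𝒮) (hS : S ∈ 𝒮) (hT : T ∈ 𝒮) :
    convexHull ℝ (J '' S) ∩ convexHull ℝ (J '' T) = convexHull ℝ (J '' (S ∩ T : Finset κ)) := by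
  refine Set.Subset.antisymm ?_ (Set.subset_inter
    (convexHull_mono (Set.image_mono (Finset.coe_subset.2 Finset.inter_subset_left)))
    (convexHull_mono (Set.image_mono (Finset.coe_subset.2 Finset.inter_subset_right))))
  rintro x ⟨hxS, hxT⟩
  obtain ⟨S', hS', v, hv, hv1, hvx⟩ := exists_pos_of_mem_convexHull_image hxS
  obtain ⟨T', hT', w, hw, hw1, hwx⟩ := exists_pos_of_mem_convexHull_image hxT
  obtain ⟨rfl, -⟩ := h S' (hdown S hS S' hS') T' (hdown T hT T' hT') v w hv hw
    (hv1.trans hw1.symm) (hvx.trans hwx.symm)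
  exact convexHull_mono (Set.image_mono (Finset.coe_subset.2 (Finset.subset_inter hS' hT')))
    (mem_convexHull_image_iff.2 ⟨v, fun i hi => (hv i hi).le, hv1, hvx⟩)

end Module

variable {κ E : Type*} {J : κ → E → ℝ} {𝒮 : Set (Finset κ)} {S T : Finset κ}

theorem isVertexSet [DecidableEq (E → ℝ)] (h : HasUniqueCombinations J 𝒮) (hS : S ∈ 𝒮) :
    IsVertexSet (S.image J) (convexHull ℝ (J '' S)) := by
  refine ⟨?_, by rw [Finset.coe_image]⟩
  have hrange : Set.range (fun i : S => J i) = (S.image J : Finset (E → ℝ)) := by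
    rw [Finset.coe_image, Set.image_eq_range]
    rfl
  have hind := (h.affineIndependent hS).range
  rwa [hrange] at hind

theorem isSimplexFace (h : HasUniqueCombinations J 𝒮) (hS : S ∈ 𝒮) (hTS : T ⊆ S) :
    IsSimplexFace (convexHull ℝ (J '' T)) (convexHull ℝ (J '' S)) := by
  classical
  exact ⟨S.image J, T.image J, h.isVertexSet hS, Finset.image_subset_image hTS,
    by rw [Finset.coe_image]⟩

theorem exists_of_isSimplexFace (h : HasUniqueCombinations J 𝒮) (hS : S ∈ 𝒮) {Δ : Set (E → ℝ)}
    (hΔ : IsSimplexFace Δ (convexHull ℝ (J '' S))) : ∃ T ⊆ S, Δ = convexHull ℝ (J '' T) := by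
  classical
  obtain ⟨s, t, hs, hts, rfl⟩ := hΔ
  obtain rfl : s = S.image J := by
    rw [← Finset.coe_inj, ← hs.extremePoints_eq, (h.isVertexSet hS).extremePoints_eq]
  obtain ⟨T, hTS, rfl⟩ := Finset.subset_image_iff.1 hts
  exact ⟨T, hTS, by rw [Finset.coe_image]⟩

theorem normalizedVolume_eq_one [Fintype E] (h : HasUniqueCombinations J 𝒮)
    (hint : ∀ i, IsIntegerPoint (J i)) (hS : S ∈ 𝒮)
    (hcoef : ∀ w : κ → ℝ, ∑ i ∈ S, w i = 0 → IsIntegerPoint (∑ i ∈ S, w i • J i) →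
      ∀ i ∈ S, ∃ n : ℤ, w i = n) {x : E → ℝ} (hx : x ∈ convexHull ℝ (J '' S)) :
    normalizedVolume (convexHull ℝ (J '' S)) x = 1 := by
  rw [Set.image_eq_range] at hx ⊢
  refine normalizedVolume_convexHull_eq_one (h.affineIndependent hS) (fun i => hint i)
    (fun u hu huJ i => ?_) hx
  have hext := Subtype.val_injective.extend_apply u (0 : κ → ℝ)
  rw [← hext]
  refine hcoef _ ?_ ?_ i i.2
  · rw [← Finset.sum_coe_sort]
    simpa only [hext] using hu
  · rw [← Finset.sum_coe_sort S fun i => Function.extend Subtype.val u (0 : κ → ℝ) i • J i]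
    simpa only [hext] using huJ

theorem isLatticeTriangulation [Finite κ] {P : Set (E → ℝ)} (h : HasUniqueCombinations J 𝒮)
    (hint : ∀ i, IsIntegerPoint (J i)) (hdown : ∀ S ∈ 𝒮, ∀ T ⊆ S, T ∈ 𝒮)
    (hP : IsIntegerPolytope P) (hcover : P = ⋃ S ∈ 𝒮, convexHull ℝ (J '' S)) :
    IsLatticeTriangulation P ((fun S : Finset κ => convexHull ℝ (J '' S)) '' 𝒮) where
  isIntegerPolytope := hP
  finite := 𝒮.toFinite.image _
  isIntegerSimplex := by
    classical
    rintro _ ⟨S, hS, rfl⟩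
    exact ⟨S.image J, Finset.forall_mem_image.2 fun i _ => hint i, h.isVertexSet hS⟩
  eq_sUnion := by rw [hcover, Set.sUnion_image]
  face_mem := by
    rintro _ ⟨S, hS, rfl⟩ Δ hΔ
    obtain ⟨T, hT, rfl⟩ := h.exists_of_isSimplexFace hS hΔ
    exact ⟨T, hdown S hS T hT, rfl⟩
  inter_face := by
    classical
    rintro _ ⟨S, hS, rfl⟩ _ ⟨T, hT, rfl⟩
    simp only [h.convexHull_inter hdown hS hT]
    exact ⟨h.isSimplexFace hS Finset.inter_subset_left,
      h.isSimplexFace hT Finset.inter_subset_right⟩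

end HasUniqueCombinations

theorem isIntegerPolytope_of_eq_iUnion_convexHull {κ E : Type*} [Finite κ] {J : κ → E → ℝ}
    {𝒮 : Set (Finset κ)} {P : Set (E → ℝ)} (hP : Convex ℝ P) (hint : ∀ i, IsIntegerPoint (J i))
    (hcover : P = ⋃ S ∈ 𝒮, convexHull ℝ (J '' S)) : IsIntegerPolytope P := by
  have hfin : (J '' ⋃ S ∈ 𝒮, S).Finite := Set.toFinite _
  refine ⟨hfin.toFinset, fun x hx => ?_, ?_⟩
  · obtain ⟨i, -, rfl⟩ := hfin.mem_toFinset.1 hx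
    exact hint i
  rw [hfin.coe_toFinset]
  refine Set.Subset.antisymm ?_ (convexHull_min ?_ hP)
  · rw [hcover]
    exact Set.iUnion₂_subset fun S hS => convexHull_mono (Set.image_mono
      (Set.subset_biUnion_of_mem (u := fun S : Finset κ => (S : Set κ)) hS))
  · rw [hcover, Set.image_iUnion₂]
    exact Set.iUnion₂_mono fun S _ => subset_convexHull _ _

theorem MultiDigraph.convex_flowPolytope {V E : Type*} [Fintype E] (G : MultiDigraph V E)
    (a : V → ℤ) : Convex ℝ (G.flowPolytope a) := by
  rintro f ⟨hf0, hf⟩ g ⟨hg0, hg⟩ s t hs ht hst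
  refine ⟨fun e => ?_, fun i => ?_⟩
  · exact add_nonneg (mul_nonneg hs (hf0 e)) (mul_nonneg ht (hg0 e))
  · simp only [Pi.add_apply, Pi.smul_apply, smul_eq_mul, Finset.sum_add_distrib, ← Finset.mul_sum]
    linear_combination s * hf i + t * hg i + (a i : ℝ) * hst

theorem MultiDigraph.sum_netflow_eq_zero {V E : Type*} [Fintype V] [Fintype E]
    {G : MultiDigraph V E} {a : V → ℤ} {f : E → ℝ} (hf : f ∈ G.flowPolytope a) :
    ∑ i, a i = 0 := by
  classical
  have hsum : ∑ i, (a i : ℝ) = 0 := by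
    simp only [← hf.2, Finset.sum_sub_distrib]
    rw [sub_eq_zero]
    trans ∑ e, f e
    · exact Finset.sum_fiberwise Finset.univ G.tail f
    · exact (Finset.sum_fiberwise Finset.univ G.head f).symm
  exact_mod_cast hsum

namespace Augmentation

variable {V E VX VY EX EY : Type*} [Fintype EX] [Fintype EY] {G : MultiDigraph V E} {a : V → ℤ}
  {A : Augmentation G a VX VY EX EY}

theorem nonempty_inflow [Finite V] [Fintype E] (ha : a ≠ 0) (A : Augmentation G a VX VY EX EY)
    {f : E → ℝ} (hf : f ∈ G.flowPolytope a) : Nonempty VX := by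
  classical
  have := Fintype.ofFinite V
  obtain ⟨i, hi⟩ : ∃ i, 0 < a i := by
    by_contra! hcon
    exact ha (funext fun i => (Finset.sum_eq_zero_iff_of_nonpos fun i _ => hcon i).1
      (MultiDigraph.sum_netflow_eq_zero hf) i (Finset.mem_univ i))
  have hcard : 0 < (Finset.univ.filter fun x => A.xHead x = i).card := by
    have := A.card_xHead i hi
    lia
  obtain ⟨x, -⟩ := Finset.card_pos.1 hcard
  exact ⟨A.xTail x⟩

theorem Framing.flowPolytope_eq_iUnion_polyhedralSimplex [Finite V] [Finite VX] [Finite VY]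
    [Fintype E] (hG : G.IsDAG) (ha : a ≠ 0) (F : A.Framing) :
    G.flowPolytope a = ⋃ S ∈ {S | F.IsLayeringSimplex S}, A.polyhedralSimplex S := by
  have : Finite A.graph.Route := (isDAG_graph hG).finite_route
  refine Set.Subset.antisymm (fun f hf => ?_) (Set.iUnion₂_subset fun S hS f hf => ?_)
  · have := A.nonempty_inflow ha hf
    obtain ⟨S, w, hS, hw, hw1, rfl⟩ := exists_isLayeringSimplex_of_mem_flowPolytope (F := F) hG hf
    exact Set.mem_iUnion₂.2 ⟨S, hS,
      mem_convexHull_image_iff.2 ⟨w, fun L hL => (hw L hL).le, hw1, rfl⟩⟩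
  · obtain ⟨w, hw, hw1, rfl⟩ := mem_convexHull_image_iff.1 hf
    exact sum_smul_layeringIndicator_mem_flowPolytope hG hS.isLayering hw hw1

theorem Framing.triangulation_eq_image (F : A.Framing) :
    F.triangulation = A.polyhedralSimplex '' {S | F.IsLayeringSimplex S} := by
  ext Δ
  exact exists_congr fun S => and_congr_right fun _ => eq_comm

theorem Framing.IsLayeringSimplex.exists_int_eq [Finite V] [Finite VX] [Finite VY] [Finite E]
    {F : A.Framing} {S : Finset (Finset A.graph.Route)} {w : Finset A.graph.Route → ℝ}
    (hG : G.IsDAG) (hS : F.IsLayeringSimplex S) (hsum : ∑ L ∈ S, w L = 0)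
    (hint : IsIntegerPoint (∑ L ∈ S, w L • A.layeringIndicator L)) :
    ∀ L ∈ S, ∃ n : ℤ, w L = n := by
  have : Finite A.graph.Route := (isDAG_graph hG).finite_route
  have hmem := hS.mem_of_sum_mem (H := (Int.castAddHom ℝ).range) hG ⟨1, by simp⟩
    (hsum ▸ AddSubgroup.zero_mem _) fun e => (hint e).imp fun n hn => hn.symm
  exact fun L hL => (hmem L hL).imp fun n hn => hn.symm

end Augmentation

theorem theorem4p6 {V E VX VY EX EY : Type*} [Fintype V] [Fintype E]
    [Fintype VX] [Fintype VY] [Fintype EX] [Fintype EY]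
    (G : MultiDigraph V E) (hG : G.IsDAG) (a : V → ℤ) (ha : a ≠ 0)
    (A : Augmentation G a VX VY EX EY) (F : A.Framing) :
    IsUnimodularTriangulation (G.flowPolytope a) F.triangulation := by
  have : Finite A.graph.Route := (Augmentation.isDAG_graph hG).finite_route
  have hunique : HasUniqueCombinations A.layeringIndicator {S | F.IsLayeringSimplex S} :=
    fun S hS T hT v w hv hw hvw h => hS.eq_of_sum_eq hG hT hv hw hvw h
  have hcover := F.flowPolytope_eq_iUnion_polyhedralSimplex hG ha
  have hint := Augmentation.isIntegerPoint_layeringIndicator (A := A)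
  have hpolytope := isIntegerPolytope_of_eq_iUnion_convexHull (G.convex_flowPolytope a) hint hcover
  rw [F.triangulation_eq_image]
  refine ⟨hunique.isLatticeTriangulation hint (fun S hS T hT => hS.mono hT) hpolytope hcover, ?_⟩
  rintro _ ⟨S, hS, rfl⟩ x hx
  exact hunique.normalizedVolume_eq_one hint hS (fun w hw hwJ => hS.exists_int_eq hG hw hwJ) hx
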